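/- Let $r\ge 1$ and let $\gamma_1,\dots,\gamma_r\in\mathbb{C}$ with $\Re\gamma_j>0$ for all $j$. For $c\in\mathbb{R}\setminus\{0\}$ put $$\widetilde{\mathfrak H}_r((t_j);(\gamma_j);c)=\prod_{j=1}^r\left(\frac{1}{\exp(\gamma_j\sum_{k=j}^r t_k)-1}-\frac{c}{\exp(c\,\gamma_j\sum_{k=j}^r t_k)-1}\right),$$ each factor being extended by its value $(c-1)/2$ at its removable singularity $\sum_{k=j}^r t_k=0$. For $\varepsilon>0$ let $\mathcal{C}=\mathcal{C}_\varepsilon$ be the Hankel contour: from $+\infty$ to $\varepsilon$ along the positive real axis with $\arg t=0$, then counterclockwise around the circle $|t|=\varepsilon$ with $\arg t$ running from $0$ to $2\pi$, then from $\varepsilon$ back to $+\infty$ along the positive real axis with $\arg t=2\pi$; powers $t^{s-1}$ on $\mathcal{C}$ are taken with this argument. The meromorphic function $1/((e^{2\pi i s}-1)\Gamma(s))$, whose only poles are $s=1,2,3,\dots$, is extended by continuity to $s=0,-1,-2,\dots$. All limits $c\to1$ are over $c\in\mathbb{R}\setminus\{1\}$. There is $\varepsilon_0>0$, depending only on $r$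 and $(\gamma_j)$, such that for every $0<\varepsilon<\varepsilon_0$ the following holds. 1. For all $(t_j)\in\mathcal{C}^r$ the limits $\lim_{c\to1}\frac{(-1)^r}{(c-1)^r}\widetilde{\mathfrak H}_r((t_j);(\gamma_j);c)$ and, for each $j$, $\lim_{c\to1}\frac{-1}{c-1}\left(\frac{1}{\exp(\gamma_j\sum_{k=j}^r t_k)-1}-\frac{c}{\exp(c\gamma_j\sum_{k=j}^r t_k)-1}\right)$ exist. For all real $c\ne1$ sufficiently close to $1$ and all $(s_j)\in\mathbb{C}^r$, the integral over $\mathcal{C}^r$ in the definition (a) below converges absolutely; so do, for all $(s_j)\in\mathbb{C}^r$, the integrals over $\mathcal{C}^r$ in (b) and (c) below. 2. For all $(s_j)\in\mathbb{C}^r$ with no $s_k$ a positive integer, the limit $$\text{(a)}\quad \zeta^{\rm des}_r((s_j);(\gamma_j)):=\lim_{c\to1}\frac{(-1)^r}{(c-1)^r}\prod_{k=1}^r\frac{1}{(e^{2\pi i s_k}-1)\Gamma(s_k)}\int_{\mathcal{C}^r}\widetilde{\mathfrak H}_r((t_j);(\gamma_j);c)\prod_{k=1}^r t_k^{s_k-1}dt_k$$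 exists (this is the definition of the desingularized multiple zeta-function), and it equals $$\text{(b)}\quad \prod_{k=1}^r\frac{1}{(e^{2\pi i s_k}-1)\Gamma(s_k)}\int_{\mathcal{C}^r}\lim_{c\to1}\frac{(-1)^r}{(c-1)^r}\widetilde{\mathfrak H}_r((t_j);(\gamma_j);c)\prod_{k=1}^r t_k^{s_k-1}dt_k$$ and $$\text{(c)}\quad \prod_{k=1}^r\frac{1}{(e^{2\pi i s_k}-1)\Gamma(s_k)}\int_{\mathcal{C}^r}\prod_{j=1}^r\lim_{c\to1}\frac{-1}{c-1}\left(\frac{1}{\exp(\gamma_j\sum_{k=j}^r t_k)-1}-\frac{c}{\exp(c\gamma_j\sum_{k=j}^r t_k)-1}\right)\prod_{k=1}^r t_k^{s_k-1}dt_k.$$ 3. The function $(s_j)\mapsto\zeta^{\rm des}_r((s_j);(\gamma_j))$ extends to an entire function on $\mathbb{C}^r$, and this function is the same for all $0<\varepsilon<\varepsilon_0$. -/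

import Mathlib

open Filter Topology MeasureTheory

noncomputable section

namespace DesingZeta

/-! The Hankel contour of radius `ε`, parametrized by `u ∈ ℝ`: for `u < 0` it runs along the
top side of the positive real axis from `+∞` to `ε` (argument `0`), for `0 ≤ u ≤ 2π`
counterclockwise around the circle of radius `ε` (argument from `0` to `2π`), and for `u > 2π`
along the bottom side of the positive real axis from `ε` to `+∞` (argument `2π`). -/

/-- Modulus of the point of the Hankel contour with parameter `u`. -/
def hankelModulus (ε u : ℝ) : ℝ :=
  if u < 0 then ε - u else if u ≤ 2 * Real.pi then ε else ε + (u - 2 * Real.pi)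

/-- Continuous argument of the point of the Hankel contour with parameter `u`. -/
def hankelArg (u : ℝ) : ℝ :=
  if u < 0 then 0 else if u ≤ 2 * Real.pi then u else 2 * Real.pi

/-- The Hankel contour as a path in `ℂ`. -/
def hankelPath (ε u : ℝ) : ℂ :=
  (hankelModulus ε u : ℂ) * Complex.exp (Complex.I * (hankelArg u : ℂ))

/-- The power `t ^ a` along the Hankel contour, for the branch
`log t = log |t| + i arg t` with the continuous argument running from `0` to `2π`. -/
def hankelPow (ε : ℝ) (a : ℂ) (u : ℝ) : ℂ :=
  Complex.exp (a * ((Real.log (hankelModulus ε u) : ℂ) + Complex.I * (hankelArg u : ℂ)))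

/-- The integrand of `∫_{𝒞^r} f(t) ∏ₖ tₖ ^ (sₖ - 1) dtₖ` in the parameters of the contour. -/
def contourIntegrand {r : ℕ} (ε : ℝ) (f : (Fin r → ℂ) → ℂ) (s : Fin r → ℂ)
    (u : Fin r → ℝ) : ℂ :=
  f (fun k => hankelPath ε (u k)) *
    ∏ k, (hankelPow ε (s k - 1) (u k) * deriv (hankelPath ε) (u k))

/-- Absolute convergence of `∫_{𝒞^r} f(t) ∏ₖ tₖ ^ (sₖ - 1) dtₖ`. -/
def ContourIntegrable {r : ℕ} (ε : ℝ) (f : (Fin r → ℂ) → ℂ) (s : Fin r → ℂ) : Prop :=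
  Integrable (contourIntegrand ε f s) volume

/-- The integral `∫_{𝒞^r} f(t) ∏ₖ tₖ ^ (sₖ - 1) dtₖ`. -/
def contourIntegral {r : ℕ} (ε : ℝ) (f : (Fin r → ℂ) → ℂ) (s : Fin r → ℂ) : ℂ :=
  ∫ u : Fin r → ℝ, contourIntegrand ε f s u

/-- The function `1 / (e ^ y - 1) - c / (e ^ (c y) - 1)` of `y`, with its removable singularity
at `y = 0` filled in by its value `(c - 1) / 2` there (for `c ≠ 0`). -/
def kernelFactor (c : ℝ) (y : ℂ) : ℂ :=
  if y = 0 then ((c : ℂ) - 1) / 2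
  else 1 / (Complex.exp y - 1) - (c : ℂ) / (Complex.exp ((c : ℂ) * y) - 1)

/-- `γⱼ ∑_{k ≥ j} tₖ`. -/
def tailArg {r : ℕ} (γ t : Fin r → ℂ) (j : Fin r) : ℂ :=
  γ j * ∑ k ∈ Finset.Ici j, t k

/-- The kernel `H̃_r((tⱼ); (γⱼ); c)`. -/
def kernelH {r : ℕ} (γ : Fin r → ℂ) (c : ℝ) (t : Fin r → ℂ) : ℂ :=
  ∏ j, kernelFactor c (tailArg γ t j)

/-- The normalized kernel `(-1)^r / (c-1)^r * H̃_r((tⱼ); (γⱼ); c)`. -/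
def normKernel {r : ℕ} (γ : Fin r → ℂ) (c : ℝ) (t : Fin r → ℂ) : ℂ :=
  (-1) ^ r / ((c : ℂ) - 1) ^ r * kernelH γ c t

/-- `lim_{c → 1} (-1)^r / (c-1)^r * H̃_r((tⱼ); (γⱼ); c)`, where `c ∈ ℝ ∖ {1}`. -/
def limKernel {r : ℕ} (γ : Fin r → ℂ) (t : Fin r → ℂ) : ℂ :=
  limUnder (𝓝[≠] (1 : ℝ)) (fun c : ℝ => normKernel γ c t)

/-- `lim_{c → 1} (-1) / (c-1) * (1 / (e ^ y - 1) - c / (e ^ (c y) - 1))`, where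
`c ∈ ℝ ∖ {1}`. -/
def limFactor (y : ℂ) : ℂ :=
  limUnder (𝓝[≠] (1 : ℝ)) (fun c : ℝ => (-1) / ((c : ℂ) - 1) * kernelFactor c y)

/-- The meromorphic function `1 / ((e ^ (2πis) - 1) Γ(s))`. Taking the limit at `s` only matters
at `s = 0, -1, -2, …`, where the zero of `e ^ (2πis) - 1` cancels the pole of `Γ`; the poles are
`s = 1, 2, 3, …`. -/
def gammaFactor (s : ℂ) : ℂ :=
  limUnder (𝓝[≠] s) (fun z : ℂ =>
    1 / ((Complex.exp (2 * (Real.pi : ℂ) * Complex.I * z) - 1) * Complex.Gamma z))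

/-- The expression whose limit as `c → 1` is the desingularized multiple zeta-function. -/
def preZetaDes {r : ℕ} (ε : ℝ) (γ s : Fin r → ℂ) (c : ℝ) : ℂ :=
  (-1) ^ r / ((c : ℂ) - 1) ^ r * (∏ k, gammaFactor (s k)) *
    contourIntegral ε (kernelH γ c) s

/-- The desingularized multiple zeta-function `ζ^des_r((sⱼ); (γⱼ))`, computed with the Hankel
contour of radius `ε`. -/
def zetaDes {r : ℕ} (ε : ℝ) (γ s : Fin r → ℂ) : ℂ :=
  limUnder (𝓝[≠] (1 : ℝ)) (fun c : ℝ => preZetaDes ε γ s c)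

end DesingZeta

end

open Filter Topology MeasureTheory

noncomputable section

namespace DesingZeta

/-! ### The generating function of the Bernoulli numbers -/

/-! With B(y) = y/(e^y - 1), each factor of the kernel equals (B(y) - B(cy))/y: the poles 1/y
cancel, and what remains is a difference quotient of x ↦ B(xy) at x = 1. After multiplication by
-1/(c - 1) it tends to B'(y), so the normalized kernel tends to ∏ B'(γ_j ∑_{k≥j} t_k), called
`regKernel`.

If Re γ > 0 and z is in a thin half strip around [0, ∞), then γz lies in a small disc about 0 or in
a sector inside the right half plane. There B is holomorphic and B' decays exponentially; the mean
value inequality gives the same decay for the factor divided by c - 1, uniformly in c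
(`exists_factor_bounds`). The tail sum with index j contains t_j, and its other terms have real part
bounded below, so the j-th factor supplies decay in t_j and the product decays in every variable
(`exists_kernel_bounds`). Exponential decay beats all powers of t, which gives absolute convergence
and, by dominated convergence, the equality of (a), (b) and (c).

For a kernel holomorphic and decaying in this sense, a contour integral depends on each variable
only through the functional that contour and weight define on holomorphic functions of one variable.
Fubini therefore permits replacing contours and weights one variable at a time
(`integral_prodIntegrand_congr`). This serves twice. Cauchy's theorem in the coordinate log t makes
different radii equivalent. At a positive integer n + 1 the power t^n integrates to zero, so t^(s-1)
may be replaced by t^(s-1) - t^n = (s - n - 1) · (difference quotient), and the factor s - n - 1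
cancels the pole of the prefactor (`exists_local_weight`). The resulting local holomorphic
extensions glue to an entire function, because they agree on the dense set where the prefactor is
regular. -/

/-- The entire function `(e ^ y - 1) / y`. -/
def expQuot (y : ℂ) : ℂ := dslope Complex.exp 0 y

/-- The function `y / (e ^ y - 1)`, holomorphic where `expQuot` does not vanish. -/
def bernoulliGen (y : ℂ) : ℂ := (expQuot y)⁻¹

lemma expQuot_of_ne {y : ℂ} (hy : y ≠ 0) : expQuot y = (Complex.exp y - 1) / y := by
  simp [expQuot, dslope_of_ne _ hy, slope_def_field]

lemma expQuot_zero : expQuot 0 = 1 := by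
  simp [expQuot]

lemma mul_expQuot (y : ℂ) : y * expQuot y = Complex.exp y - 1 := by
  rcases eq_or_ne y 0 with rfl | hy
  · simp
  · rw [expQuot_of_ne hy]; field_simp

lemma differentiable_expQuot : Differentiable ℂ expQuot := by
  rw [← differentiableOn_univ]
  exact (Complex.differentiableOn_dslope univ_mem).2 Complex.differentiable_exp.differentiableOn

lemma expQuot_ne_zero_iff {y : ℂ} (hy : y ≠ 0) : expQuot y ≠ 0 ↔ Complex.exp y - 1 ≠ 0 := by
  rw [expQuot_of_ne hy]; simp [hy]

lemma bernoulliGen_of_ne {y : ℂ} (hy : y ≠ 0) : bernoulliGen y = y / (Complex.exp y - 1) := by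
  rw [bernoulliGen, expQuot_of_ne hy, inv_div]

lemma differentiableAt_bernoulliGen {y : ℂ} (hy : expQuot y ≠ 0) :
    DifferentiableAt ℂ bernoulliGen y :=
  (differentiable_expQuot y).inv hy

lemma isOpen_expQuot_ne_zero : IsOpen {y | expQuot y ≠ 0} :=
  isOpen_ne_fun differentiable_expQuot.continuous continuous_const

lemma differentiableOn_bernoulliGen : DifferentiableOn ℂ bernoulliGen {y | expQuot y ≠ 0} :=
  fun _ hy => (differentiableAt_bernoulliGen hy).differentiableWithinAt

lemma differentiableAt_deriv_bernoulliGen {y : ℂ} (hy : expQuot y ≠ 0) :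
    DifferentiableAt ℂ (deriv bernoulliGen) y :=
  (differentiableOn_bernoulliGen.deriv isOpen_expQuot_ne_zero).differentiableAt
    (isOpen_expQuot_ne_zero.mem_nhds hy)

lemma measurable_deriv_bernoulliGen : Measurable (deriv bernoulliGen) := measurable_deriv _

lemma expQuot_add_mul_deriv (y : ℂ) : expQuot y + y * deriv expQuot y = Complex.exp y := by
  have h1 : HasDerivAt (fun y => y * expQuot y) (1 * expQuot y + y * deriv expQuot y) y :=
    (hasDerivAt_id y).mul (differentiable_expQuot y).hasDerivAt
  have h2 : HasDerivAt (fun y => y * expQuot y) (Complex.exp y) y := by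
    simp_rw [mul_expQuot]
    exact (Complex.hasDerivAt_exp y).sub_const 1
  simpa using h1.unique h2

/-- Differentiating `expQuot_add_mul_deriv` at 0 gives twice this derivative equal to 1. It makes
the filled-in value (c - 1)/2 of the kernel factor consistent with B'(0) = -1/2. -/
lemma deriv_expQuot_zero : deriv expQuot 0 = 1 / 2 := by
  have hd : DifferentiableAt ℂ (deriv expQuot) 0 :=
    (differentiable_expQuot.differentiableOn.deriv isOpen_univ).differentiableAt univ_mem
  have h1 : HasDerivAt (fun y => y * deriv expQuot y)
      (1 * deriv expQuot 0 + 0 * deriv (deriv expQuot) 0) 0 :=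
    (hasDerivAt_id (0 : ℂ)).mul hd.hasDerivAt
  have h2 : HasDerivAt (fun y => y * deriv expQuot y) (Complex.exp 0 - deriv expQuot 0) 0 := by
    have : (fun y => y * deriv expQuot y) = fun y => Complex.exp y - expQuot y := by
      funext y; rw [← expQuot_add_mul_deriv y]; ring
    rw [this]
    exact (Complex.hasDerivAt_exp 0).sub (differentiable_expQuot 0).hasDerivAt
  have h := h1.unique h2
  simp only [Complex.exp_zero] at h
  linear_combination h / 2

lemma deriv_bernoulliGen {y : ℂ} (hy : expQuot y ≠ 0) :
    deriv bernoulliGen y = -deriv expQuot y / expQuot y ^ 2 :=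
  ((differentiable_expQuot y).hasDerivAt.inv hy).deriv

lemma deriv_bernoulliGen_zero : deriv bernoulliGen 0 = -1 / 2 := by
  rw [deriv_bernoulliGen (by simp [expQuot_zero]), deriv_expQuot_zero, expQuot_zero]; norm_num

lemma deriv_bernoulliGen_of_ne {y : ℂ} (hy : y ≠ 0) (h : Complex.exp y - 1 ≠ 0) :
    deriv bernoulliGen y
      = (Complex.exp y - 1 - y * Complex.exp y) / (Complex.exp y - 1) ^ 2 := by
  have h1 := expQuot_add_mul_deriv y
  have h2 := expQuot_of_ne hy
  rw [deriv_bernoulliGen ((expQuot_ne_zero_iff hy).2 h)]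
  have h3 : deriv expQuot y = (Complex.exp y - (Complex.exp y - 1) / y) / y := by
    rw [eq_div_iff hy, ← h2]; linear_combination h1
  rw [h3, h2]
  field_simp
  ring

/-! ### The factors of the kernel -/

/-- Since c/(e^(cy) - 1) = B(cy)/y, both terms have the same singular part 1/y. All later estimates
on the factor come from this form. -/
lemma kernelFactor_eq {c : ℝ} (hc : c ≠ 0) {y : ℂ} (hy : y ≠ 0) :
    kernelFactor c y = (bernoulliGen y - bernoulliGen (c * y)) / y := by
  have hc' : (c : ℂ) ≠ 0 := by exact_mod_cast hc
  rw [kernelFactor, if_neg hy, bernoulliGen_of_ne hy, bernoulliGen_of_ne (mul_ne_zero hc' hy)]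
  rw [sub_div]
  congr 1
  · rw [div_right_comm, div_self hy]
  · rw [div_right_comm, mul_div_assoc, div_self hy, mul_one]

/-- The derivative of x ↦ B(xy) at x = 1 is y B'(y), and the division by y removes the factor y. At
y = 0 the expression is constant in c. -/
lemma tendsto_kernelFactor {y : ℂ} (h : expQuot y ≠ 0) :
    Tendsto (fun c : ℝ => (-1) / ((c : ℂ) - 1) * kernelFactor c y) (𝓝[≠] 1)
      (𝓝 (deriv bernoulliGen y)) := by
  rcases eq_or_ne y 0 with rfl | hy
  · rw [deriv_bernoulliGen_zero]
    refine tendsto_const_nhds.congr' ?_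
    filter_upwards [self_mem_nhdsWithin] with c hc
    have : (c : ℂ) - 1 ≠ 0 := by
      rw [sub_ne_zero]; exact_mod_cast hc
    simp only [kernelFactor, if_true]
    field_simp
  · have h1 : HasDerivAt (fun x : ℝ => bernoulliGen ((x : ℂ) * y))
        (deriv bernoulliGen y * (1 * y)) 1 := by
      have h2 : HasDerivAt (fun x : ℂ => x * y) (1 * y) ((1 : ℝ) : ℂ) :=
        (hasDerivAt_id _).mul_const y
      have h3 : HasDerivAt bernoulliGen (deriv bernoulliGen y) (((1 : ℝ) : ℂ) * y) := by
        simpa using (differentiableAt_bernoulliGen h).hasDerivAt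
      exact (h3.comp ((1 : ℝ) : ℂ) h2).comp_ofReal
    rw [hasDerivAt_iff_tendsto_slope] at h1
    have h4 := h1.div_const y
    rw [one_mul, mul_div_cancel_right₀ _ hy] at h4
    refine h4.congr' ?_
    have h0 : ∀ᶠ c : ℝ in 𝓝[≠] 1, c ≠ 0 :=
      eventually_nhdsWithin_of_eventually_nhds (eventually_ne_nhds one_ne_zero)
    filter_upwards [self_mem_nhdsWithin, h0] with c hc hc0
    have : (c : ℂ) - 1 ≠ 0 := by
      rw [sub_ne_zero]; exact_mod_cast hc
    rw [kernelFactor_eq hc0 hy]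
    simp only [slope, vsub_eq_sub, Complex.ofReal_one, one_mul, Complex.real_smul]
    push_cast
    field_simp
    ring

lemma limFactor_eq {y : ℂ} (h : expQuot y ≠ 0) : limFactor y = deriv bernoulliGen y :=
  (tendsto_kernelFactor h).limUnder_eq

/-! ### Regularity and exponential decay near the positive real axis -/

lemma exp_sub_one_ne_zero_of_re_pos {y : ℂ} (hy : 0 < y.re) : Complex.exp y - 1 ≠ 0 := by
  intro h
  have h1 : ‖Complex.exp y‖ = 1 := by rw [sub_eq_zero.1 h]; simp
  rw [Complex.norm_exp] at h1
  have := Real.exp_eq_one_iff y.re |>.1 h1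
  linarith

/-- The zeros of e^y - 1 are the points 2πin: none but 0 has norm at most 2, and none lies in the
open right half plane. -/
lemma expQuot_ne_zero {κ : ℝ} (hκ : 0 < κ) {y : ℂ} (h : ‖y‖ ≤ 2 ∨ κ * ‖y‖ ≤ y.re) :
    expQuot y ≠ 0 := by
  rcases eq_or_ne y 0 with rfl | hy
  · simp [expQuot_zero]
  rw [expQuot_ne_zero_iff hy]
  rcases h with h | h
  · intro h1
    obtain ⟨n, hn⟩ := Complex.exp_eq_one_iff.1 (sub_eq_zero.1 h1)
    have hn0 : n ≠ 0 := by rintro rfl; simp at hn; exact hy hn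
    have : (1 : ℝ) ≤ |(n : ℝ)| := by exact_mod_cast Int.one_le_abs hn0
    rw [hn] at h
    simp only [Complex.norm_mul, Complex.norm_intCast, Complex.norm_ofNat, Complex.norm_real,
      Real.norm_eq_abs, Complex.norm_I, mul_one, abs_of_pos Real.pi_pos] at h
    nlinarith [Real.pi_gt_three]
  · exact exp_sub_one_ne_zero_of_re_pos ((mul_pos hκ (norm_pos_iff.2 hy)).trans_le h)

/-- Compactness handles the disc. In the sector, B'(y) is of size |y| e^(-Re y) with Re y ≥ κ|y|,
and half of the rate κ is spent on absorbing the linear factor. -/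
lemma exists_norm_deriv_bernoulliGen_le {κ : ℝ} (hκ : 0 < κ) :
    ∃ C : ℝ, 0 ≤ C ∧ ∀ y : ℂ, (‖y‖ ≤ 2 ∨ κ * ‖y‖ ≤ y.re) →
      ‖deriv bernoulliGen y‖ ≤ C * Real.exp (-(κ / 2) * ‖y‖) := by
  have hcont : ContinuousOn (fun y => ‖deriv bernoulliGen y‖) (Metric.closedBall 0 2) := by
    intro y hy
    exact (differentiableAt_deriv_bernoulliGen (expQuot_ne_zero one_pos
      (Or.inl (by simpa using hy)))).continuousAt.norm.continuousWithinAt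
  obtain ⟨C₁, hC₁⟩ := (isCompact_closedBall (0 : ℂ) 2).bddAbove_image hcont
  have hC₁' : ∀ y : ℂ, ‖y‖ ≤ 2 → ‖deriv bernoulliGen y‖ ≤ C₁ := fun y hy =>
    hC₁ ⟨y, by simpa using hy, rfl⟩
  have hC₁0 : 0 ≤ C₁ := (norm_nonneg _).trans (hC₁' 0 (by simp))
  -- For ‖y‖ > 2 in the sector, Re y ≥ κ, hence |e^y - 1| ≥ q e^(Re y).
  set q : ℝ := 1 - Real.exp (-κ) with hq
  have hq0 : 0 < q := by rw [hq, sub_pos]; rw [Real.exp_lt_one_iff]; linarith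
  set A : ℝ := (2 + 2 / κ) / q ^ 2 with hA
  have hA0 : 0 ≤ A := by positivity
  -- The factor e^κ undoes the smallest value e^(-κ) of the majorant on the disc of radius 2.
  refine ⟨C₁ * Real.exp κ + A, by positivity, fun y hy => ?_⟩
  rcases le_or_gt ‖y‖ 2 with h2 | h2
  · have h3 : (1 : ℝ) ≤ Real.exp κ * Real.exp (-(κ / 2) * ‖y‖) := by
      rw [← Real.exp_add]; apply Real.one_le_exp; nlinarith
    calc ‖deriv bernoulliGen y‖ ≤ C₁ * 1 := by simpa using hC₁' y h2
      _ ≤ C₁ * (Real.exp κ * Real.exp (-(κ / 2) * ‖y‖)) := by gcongr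
      _ ≤ _ := by
        rw [add_mul, mul_assoc]
        have : 0 ≤ A * Real.exp (-(κ / 2) * ‖y‖) := by positivity
        linarith
  · have hre : κ * ‖y‖ ≤ y.re := hy.resolve_left (not_le.2 h2)
    have hy0 : y ≠ 0 := by rintro rfl; simp at h2; linarith
    have hrepos : 0 < y.re := by nlinarith
    have hκre : κ ≤ y.re := by nlinarith
    rw [deriv_bernoulliGen_of_ne hy0 (exp_sub_one_ne_zero_of_re_pos hrepos), norm_div, norm_pow]
    have hE : ‖Complex.exp y‖ = Real.exp y.re := Complex.norm_exp y
    have hE1 : 1 ≤ Real.exp y.re := Real.one_le_exp hrepos.le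
    have hden : q * Real.exp y.re ≤ ‖Complex.exp y - 1‖ := by
      have h4 : ‖Complex.exp y‖ - ‖(1 : ℂ)‖ ≤ ‖Complex.exp y - 1‖ := norm_sub_norm_le _ _
      rw [hE, norm_one] at h4
      have h5 : 1 ≤ Real.exp (-κ) * Real.exp y.re := by
        rw [← Real.exp_add]; apply Real.one_le_exp; linarith
      rw [hq]; linarith
    have hnum : ‖Complex.exp y - 1 - y * Complex.exp y‖ ≤ (2 + ‖y‖) * Real.exp y.re := by
      calc ‖Complex.exp y - 1 - y * Complex.exp y‖
          ≤ ‖Complex.exp y‖ + ‖(1 : ℂ)‖ + ‖y * Complex.exp y‖ :=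
            (norm_sub_le _ _).trans (by gcongr; exact norm_sub_le _ _)
        _ = Real.exp y.re + 1 + ‖y‖ * Real.exp y.re := by rw [norm_mul, hE, norm_one]
        _ ≤ _ := by linarith
    have hlin : 2 + ‖y‖ ≤ (2 + 2 / κ) * Real.exp (κ / 2 * ‖y‖) := by
      have h6 : κ / 2 * ‖y‖ + 1 ≤ Real.exp (κ / 2 * ‖y‖) := Real.add_one_le_exp _
      have h7 : 1 ≤ Real.exp (κ / 2 * ‖y‖) := Real.one_le_exp (by positivity)
      have h8 : ‖y‖ = 2 / κ * (κ / 2 * ‖y‖) := by field_simp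
      have h9 : 2 / κ * (κ / 2 * ‖y‖) ≤ 2 / κ * Real.exp (κ / 2 * ‖y‖) := by
        gcongr; linarith
      linarith
    calc ‖Complex.exp y - 1 - y * Complex.exp y‖ / ‖Complex.exp y - 1‖ ^ 2
        ≤ (2 + ‖y‖) * Real.exp y.re / (q * Real.exp y.re) ^ 2 := by gcongr
      _ = (2 + ‖y‖) / q ^ 2 * Real.exp (-y.re) := by
        rw [Real.exp_neg]; field_simp
      _ ≤ ((2 + 2 / κ) * Real.exp (κ / 2 * ‖y‖)) / q ^ 2 * Real.exp (-(κ * ‖y‖)) := by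
        gcongr
      _ = A * Real.exp (-(κ / 2) * ‖y‖) := by
        have : Real.exp (-(κ / 2) * ‖y‖) = Real.exp (κ / 2 * ‖y‖) * Real.exp (-(κ * ‖y‖)) := by
          rw [← Real.exp_add]; congr 1; ring
        rw [this, hA]; ring
      _ ≤ _ := by gcongr; nlinarith [Real.exp_pos κ]

/-- Mean value inequality for x ↦ B(xy) on [1/2, 3/2]. The disc shrinks to radius 1 so that xy stays
in the disc of radius 2, and the rate drops to κ/4 because x may be as small as 1/2. -/
lemma exists_norm_kernelFactor_le {κ : ℝ} (hκ : 0 < κ) :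
    ∃ C : ℝ, 0 ≤ C ∧ ∀ y : ℂ, (‖y‖ ≤ 1 ∨ κ * ‖y‖ ≤ y.re) → ∀ c : ℝ, |c - 1| ≤ 1 / 2 →
      ‖kernelFactor c y‖ ≤ |c - 1| * (C * Real.exp (-(κ / 4) * ‖y‖)) := by
  obtain ⟨C, hC0, hC⟩ := exists_norm_deriv_bernoulliGen_le hκ
  -- The extra 1 covers y = 0, where the factor has norm |c - 1|/2.
  refine ⟨C + 1, by positivity, fun y hy c hc => ?_⟩
  rcases eq_or_ne y 0 with rfl | hy0
  · have : ‖(c : ℂ) - 1‖ = |c - 1| := by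
      rw [← Complex.ofReal_one, ← Complex.ofReal_sub, Complex.norm_real, Real.norm_eq_abs]
    simp only [kernelFactor, if_true, norm_div, this, Complex.norm_ofNat, norm_zero, mul_zero,
      Real.exp_zero, mul_one]
    nlinarith [abs_nonneg (c - 1)]
  have hmem : ∀ x ∈ Set.Icc (1 / 2 : ℝ) (3 / 2),
      ‖(x : ℂ) * y‖ ≤ 2 ∨ κ * ‖(x : ℂ) * y‖ ≤ ((x : ℂ) * y).re := by
    intro x hx
    have hx0 : 0 < x := by linarith [hx.1]
    rw [norm_mul, Complex.norm_real, Real.norm_of_nonneg hx0.le, Complex.re_ofReal_mul]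
    rcases hy with h | h
    · left; nlinarith [hx.2, norm_nonneg y]
    · right; nlinarith
  rw [abs_le] at hc
  have hc1 : c ∈ Set.Icc (1 / 2 : ℝ) (3 / 2) := ⟨by linarith [hc.1], by linarith [hc.2]⟩
  have h1 : (1 : ℝ) ∈ Set.Icc (1 / 2 : ℝ) (3 / 2) := by constructor <;> norm_num
  have key := (convex_Icc (1 / 2 : ℝ) (3 / 2)).norm_image_sub_le_of_norm_hasDerivWithin_le
    (f := fun x : ℝ => bernoulliGen ((x : ℂ) * y))
    (f' := fun x : ℝ => deriv bernoulliGen ((x : ℂ) * y) * (1 * y))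
    (C := C * Real.exp (-(κ / 4) * ‖y‖) * ‖y‖) (x := c) (y := 1)
    (fun x hx => by
      have h2 : HasDerivAt (fun x : ℂ => x * y) (1 * y) (x : ℂ) := (hasDerivAt_id _).mul_const y
      have h3 := (differentiableAt_bernoulliGen (expQuot_ne_zero hκ (hmem x hx))).hasDerivAt
      exact ((h3.comp (x : ℂ) h2).comp_ofReal).hasDerivWithinAt)
    (fun x hx => by
      rw [one_mul, norm_mul]
      gcongr
      refine (hC _ (hmem x hx)).trans ?_
      refine mul_le_mul_of_nonneg_left (Real.exp_le_exp.2 ?_) hC0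
      have hx0 : 0 < x := by linarith [hx.1]
      rw [norm_mul, Complex.norm_real, Real.norm_of_nonneg hx0.le]
      have : 0 ≤ κ * ‖y‖ := by positivity
      nlinarith [hx.1])
    hc1 h1
  have hc0 : c ≠ 0 := by linarith [hc.1]
  rw [kernelFactor_eq hc0 hy0, norm_div, div_le_iff₀ (norm_pos_iff.2 hy0)]
  have key' : ‖bernoulliGen y - bernoulliGen (c * y)‖
      ≤ C * Real.exp (-(κ / 4) * ‖y‖) * ‖y‖ * |c - 1| := by
    simpa [abs_sub_comm] using key
  refine key'.trans ?_
  have : 0 ≤ |c - 1| * Real.exp (-(κ / 4) * ‖y‖) * ‖y‖ := by positivity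
  nlinarith

/-- The half strip around the positive real axis. -/
def halfStrip (δ : ℝ) : Set ℂ := {z | -δ < z.re ∧ |z.im| < δ}

/-- Outside the disc Re z ≥ |z| - δ, so Re(γz) ≥ Re γ · (|z| - δ) - |γ|δ ≥ Re γ · |z| - 2|γ|δ. The
choice of δ makes the error at most half of the main term as soon as |γz| > 1. -/
lemma exists_mul_mem_sector {γ : ℂ} (hγ : 0 < γ.re) :
    ∃ δ κ : ℝ, 0 < δ ∧ 0 < κ ∧ ∀ z ∈ halfStrip δ,
      ‖γ * z‖ ≤ 1 ∨ κ * ‖γ * z‖ ≤ (γ * z).re := by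
  have hn : 0 < ‖γ‖ := hγ.trans_le (Complex.re_le_norm γ)
  refine ⟨γ.re / (4 * ‖γ‖ ^ 2), γ.re / (2 * ‖γ‖), by positivity, by positivity, fun z hz => ?_⟩
  set δ := γ.re / (4 * ‖γ‖ ^ 2) with hδ
  obtain ⟨h1, h2⟩ := hz
  by_cases h : ‖γ * z‖ ≤ 1
  · exact Or.inl h
  right
  rw [norm_mul, not_le] at h
  have hδ1 : 4 * ‖γ‖ ^ 2 * δ = γ.re := by rw [hδ]; field_simp
  have hre : γ.re ≤ ‖γ‖ := Complex.re_le_norm γ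
  have him : |γ.im| ≤ ‖γ‖ := Complex.abs_im_le_norm γ
  have hδ0 : 0 < δ := by positivity
  have hδ4 : 4 * ‖γ‖ * δ ≤ 1 := by
    by_contra hcon
    push Not at hcon
    nlinarith
  have habs : ‖z‖ ≤ |z.re| + |z.im| := Complex.norm_le_abs_re_add_abs_im z
  have hzre : ‖z‖ - δ ≤ z.re := by
    rcases le_total 0 z.re with h0 | h0
    · rw [abs_of_nonneg h0] at habs; linarith
    · rw [abs_of_nonpos h0] at habs
      -- Then ‖γz‖ ≤ 2‖γ‖δ ≤ 1/2, contrary to the assumption that γz is outside the unit disc.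
      have : ‖z‖ ≤ 2 * δ := by linarith
      have : ‖γ‖ * ‖z‖ ≤ ‖γ‖ * (2 * δ) := by gcongr
      linarith
  have hprod : γ.im * z.im ≤ ‖γ‖ * δ := by
    calc γ.im * z.im ≤ |γ.im| * |z.im| := by rw [← abs_mul]; exact le_abs_self _
      _ ≤ ‖γ‖ * δ := by gcongr
  rw [norm_mul, Complex.mul_re]
  have e1 : γ.re / (2 * ‖γ‖) * (‖γ‖ * ‖z‖) = γ.re * ‖z‖ / 2 := by field_simp
  rw [e1]
  have e2 : γ.re * (‖z‖ - δ) ≤ γ.re * z.re := by gcongr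
  have e3 : γ.re * δ ≤ ‖γ‖ * δ := by gcongr
  have e4 : ‖γ‖ * (4 * ‖γ‖ * δ) ≤ ‖γ‖ * (4 * ‖γ‖ * δ) * (‖γ‖ * ‖z‖) := by
    have : 0 ≤ ‖γ‖ * (4 * ‖γ‖ * δ) := by positivity
    nlinarith
  have e5 : 4 * (‖γ‖ * δ) ≤ γ.re * ‖z‖ := by
    have : ‖γ‖ * (4 * (‖γ‖ * δ)) ≤ ‖γ‖ * (γ.re * ‖z‖) := by
      calc _ = ‖γ‖ * (4 * ‖γ‖ * δ) := by ring
        _ ≤ _ := e4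
        _ = (4 * ‖γ‖ ^ 2 * δ) * (‖γ‖ * ‖z‖) := by ring
        _ = _ := by rw [hδ1]; ring
    exact le_of_mul_le_mul_left this hn
  linarith

/-- On a thin half strip a factor of the kernel is regular and, divided by `c - 1`,
decays exponentially, uniformly in `c`. -/
lemma exists_factor_bounds {γ : ℂ} (hγ : 0 < γ.re) :
    ∃ δ b C : ℝ, 0 < δ ∧ 0 < b ∧ 0 ≤ C ∧ ∀ z ∈ halfStrip δ,
      expQuot (γ * z) ≠ 0 ∧
      ‖deriv bernoulliGen (γ * z)‖ ≤ C * Real.exp (-b * z.re) ∧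
      ∀ c : ℝ, |c - 1| ≤ 1 / 2 →
        ‖kernelFactor c (γ * z)‖ ≤ |c - 1| * (C * Real.exp (-b * z.re)) := by
  obtain ⟨δ, κ, hδ, hκ, hmem⟩ := exists_mul_mem_sector hγ
  obtain ⟨C₁, hC₁0, hC₁⟩ := exists_norm_deriv_bernoulliGen_le hκ
  obtain ⟨C₂, hC₂0, hC₂⟩ := exists_norm_kernelFactor_le hκ
  have hn : 0 < ‖γ‖ := hγ.trans_le (Complex.re_le_norm γ)
  refine ⟨δ, κ / 4 * ‖γ‖, C₁ + C₂, hδ, by positivity, by positivity, fun z hz => ?_⟩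
  have hz2 : ‖γ * z‖ ≤ 2 ∨ κ * ‖γ * z‖ ≤ (γ * z).re :=
    (hmem z hz).imp_left fun h => h.trans one_le_two
  have hexp : Real.exp (-(κ / 4) * ‖γ * z‖) ≤ Real.exp (-(κ / 4 * ‖γ‖) * z.re) := by
    rw [norm_mul]
    have : κ / 4 * ‖γ‖ * z.re ≤ κ / 4 * ‖γ‖ * ‖z‖ := by
      gcongr; exact Complex.re_le_norm z
    rw [Real.exp_le_exp]; linarith
  have hexp2 : Real.exp (-(κ / 2) * ‖γ * z‖) ≤ Real.exp (-(κ / 4) * ‖γ * z‖) := by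
    rw [Real.exp_le_exp]
    have : 0 ≤ κ * ‖γ * z‖ := by positivity
    linarith
  refine ⟨expQuot_ne_zero hκ hz2, (hC₁ _ hz2).trans ?_, fun c hc => (hC₂ _ (hmem z hz) c hc).trans ?_⟩
  · have := hexp2.trans hexp
    gcongr; linarith
  · gcongr; linarith

lemma measurable_kernelFactor (c : ℝ) : Measurable (kernelFactor c) := by
  unfold kernelFactor
  refine Measurable.ite (measurableSet_singleton 0) measurable_const ?_
  fun_prop

/-! ### The Hankel contour -/

/-- The branch of the logarithm along the Hankel contour. -/
def hankelLog (ε u : ℝ) : ℂ := (Real.log (hankelModulus ε u) : ℂ) + Complex.I * (hankelArg u : ℂ)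

lemma hankelPow_eq (ε : ℝ) (a : ℂ) (u : ℝ) : hankelPow ε a u = Complex.exp (a * hankelLog ε u) := rfl

lemma hankelPath_of_neg {ε u : ℝ} (hu : u < 0) : hankelPath ε u = ((ε - u : ℝ) : ℂ) := by
  simp [hankelPath, hankelModulus, hankelArg, hu]

lemma hankelPath_of_mem {ε u : ℝ} (h0 : 0 ≤ u) (h1 : u ≤ 2 * Real.pi) :
    hankelPath ε u = ε * Complex.exp (Complex.I * u) := by
  simp [hankelPath, hankelModulus, hankelArg, not_lt.2 h0, h1]

lemma hankelPath_of_gt {ε u : ℝ} (hu : 2 * Real.pi < u) :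
    hankelPath ε u = ((ε + (u - 2 * Real.pi) : ℝ) : ℂ) := by
  have h0 : ¬ u < 0 := by linarith [Real.pi_pos]
  have h2 : Complex.exp (Complex.I * (2 * Real.pi)) = 1 := by
    rw [mul_comm]; exact Complex.exp_two_pi_mul_I
  simp [hankelPath, hankelModulus, hankelArg, h0, not_le.2 hu, h2]

lemma hankelLog_of_neg {ε u : ℝ} (hu : u < 0) : hankelLog ε u = Real.log (ε - u) := by
  simp [hankelLog, hankelModulus, hankelArg, hu]

lemma hankelLog_of_mem {ε u : ℝ} (h0 : 0 ≤ u) (h1 : u ≤ 2 * Real.pi) :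
    hankelLog ε u = Real.log ε + Complex.I * u := by
  simp [hankelLog, hankelModulus, hankelArg, not_lt.2 h0, h1]

lemma hankelLog_of_gt {ε u : ℝ} (hu : 2 * Real.pi < u) :
    hankelLog ε u = Real.log (ε + (u - 2 * Real.pi)) + Complex.I * (2 * Real.pi) := by
  have h0 : ¬ u < 0 := by linarith [Real.pi_pos]
  simp [hankelLog, hankelModulus, hankelArg, h0, not_le.2 hu]

lemma measurable_hankelModulus (ε : ℝ) : Measurable (hankelModulus ε) := by
  unfold hankelModulus
  refine Measurable.ite measurableSet_Iio (by fun_prop) (Measurable.ite measurableSet_Iic ?_ ?_) <;>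
    fun_prop

lemma measurable_hankelArg : Measurable hankelArg := by
  unfold hankelArg
  refine Measurable.ite measurableSet_Iio (by fun_prop) (Measurable.ite measurableSet_Iic ?_ ?_) <;>
    fun_prop

lemma measurable_hankelPath (ε : ℝ) : Measurable (hankelPath ε) := by
  have h1 := measurable_hankelModulus ε
  have h2 := measurable_hankelArg
  unfold hankelPath
  fun_prop

lemma measurable_hankelLog (ε : ℝ) : Measurable (hankelLog ε) := by
  have h1 := measurable_hankelModulus ε
  have h2 := measurable_hankelArg
  unfold hankelLog
  fun_prop

lemma measurable_hankelPow (ε : ℝ) (a : ℂ) : Measurable (hankelPow ε a) := by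
  have h1 := measurable_hankelLog ε
  simp only [funext (hankelPow_eq ε a)]
  fun_prop

lemma measurable_deriv_hankelPath (ε : ℝ) : Measurable (deriv (hankelPath ε)) := measurable_deriv _

lemma le_hankelModulus {ε : ℝ} (u : ℝ) : ε ≤ hankelModulus ε u := by
  unfold hankelModulus
  split_ifs <;> linarith

lemma abs_sub_le_hankelModulus {ε : ℝ} (hε : 0 < ε) (u : ℝ) :
    |u| - 2 * Real.pi ≤ hankelModulus ε u := by
  have := Real.pi_pos
  unfold hankelModulus
  split_ifs with h1 h2
  · rw [abs_of_neg h1]; linarith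
  · rw [abs_of_nonneg (not_lt.1 h1)]; linarith
  · rw [abs_of_nonneg (not_lt.1 h1)]; linarith

lemma abs_hankelArg_le (u : ℝ) : |hankelArg u| ≤ 2 * Real.pi := by
  have := Real.pi_pos
  unfold hankelArg
  split_ifs with h1 h2
  · simp [this.le]
  · rwa [abs_of_nonneg (not_lt.1 h1)]
  · rw [abs_of_nonneg (by positivity)]

lemma norm_hankelLog_le (ε u : ℝ) :
    ‖hankelLog ε u‖ ≤ |Real.log (hankelModulus ε u)| + 2 * Real.pi := by
  refine (norm_add_le _ _).trans ?_
  rw [norm_mul, Complex.norm_I, one_mul, Complex.norm_real, Complex.norm_real]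
  exact add_le_add le_rfl (abs_hankelArg_le u)

lemma hankelModulus_le_re {ε : ℝ} (hε : 0 < ε) (u : ℝ) :
    hankelModulus ε u - 2 * ε ≤ (hankelPath ε u).re := by
  rcases lt_or_ge u 0 with h | h
  · rw [hankelPath_of_neg h, Complex.ofReal_re, hankelModulus, if_pos h]; linarith
  rcases le_or_gt u (2 * Real.pi) with h' | h'
  · rw [hankelPath_of_mem h h', Complex.re_ofReal_mul, hankelModulus, if_neg (not_lt.2 h), if_pos h']
    have h1 : |(Complex.exp (Complex.I * u)).re| ≤ 1 := by
      refine (Complex.abs_re_le_norm _).trans ?_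
      rw [mul_comm, Complex.norm_exp_ofReal_mul_I]
    have := (abs_le.1 h1).1
    nlinarith
  · rw [hankelPath_of_gt h', Complex.ofReal_re, hankelModulus, if_neg (not_lt.2 h),
      if_neg (not_le.2 h')]
    linarith

lemma closedBall_subset_halfStrip {ε δ : ℝ} (h : ε < δ) :
    Metric.closedBall (0 : ℂ) ε ⊆ halfStrip δ := by
  intro z hz
  rw [mem_closedBall_zero_iff] at hz
  have h1 := (abs_le.1 ((Complex.abs_re_le_norm z).trans hz)).1
  have h2 := (Complex.abs_im_le_norm z).trans hz
  exact ⟨by linarith, by linarith⟩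

lemma ofReal_mem_halfStrip {x δ : ℝ} (hδ : 0 < δ) (hx : 0 ≤ x) : (x : ℂ) ∈ halfStrip δ := by
  constructor
  · rw [Complex.ofReal_re]; linarith
  · simpa using hδ

lemma norm_mul_exp_I {ε : ℝ} (hε : 0 < ε) (u : ℝ) : ‖(ε : ℂ) * Complex.exp (Complex.I * u)‖ = ε := by
  rw [norm_mul, mul_comm Complex.I, Complex.norm_exp_ofReal_mul_I, mul_one, Complex.norm_real,
    Real.norm_of_nonneg hε.le]

lemma hankelPath_mem_halfStrip {ε δ : ℝ} (hε : 0 < ε) (hδ : ε < δ) (u : ℝ) :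
    hankelPath ε u ∈ halfStrip δ := by
  rcases lt_or_ge u 0 with h | h
  · rw [hankelPath_of_neg h]
    exact ofReal_mem_halfStrip (hε.trans hδ) (by linarith)
  rcases le_or_gt u (2 * Real.pi) with h' | h'
  · rw [hankelPath_of_mem h h']
    refine closedBall_subset_halfStrip hδ ?_
    rw [mem_closedBall_zero_iff, norm_mul_exp_I hε]
  · rw [hankelPath_of_gt h']
    exact ofReal_mem_halfStrip (hε.trans hδ) (by linarith)

lemma deriv_hankelPath_of_neg {ε u : ℝ} (hu : u < 0) : deriv (hankelPath ε) u = -1 := by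
  have h1 : HasDerivAt (fun u : ℝ => ((ε - u : ℝ) : ℂ)) ((-1 : ℝ) : ℂ) u :=
    ((hasDerivAt_id u).const_sub ε).ofReal_comp
  have h2 : hankelPath ε =ᶠ[𝓝 u] fun u : ℝ => ((ε - u : ℝ) : ℂ) := by
    filter_upwards [Iio_mem_nhds hu] with v hv using hankelPath_of_neg hv
  rw [(h1.congr_of_eventuallyEq h2).deriv]; simp

lemma deriv_hankelPath_of_mem {ε u : ℝ} (h0 : 0 < u) (h1 : u < 2 * Real.pi) :
    deriv (hankelPath ε) u = Complex.I * (ε * Complex.exp (Complex.I * u)) := by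
  have h2 : HasDerivAt (fun u : ℝ => (ε : ℂ) * Complex.exp (Complex.I * u))
      ((ε : ℂ) * (Complex.exp (Complex.I * u) * (Complex.I * 1))) u := by
    have h3 : HasDerivAt (fun z : ℂ => Complex.I * z) (Complex.I * 1) (u : ℂ) :=
      (hasDerivAt_id _).const_mul _
    exact (h3.cexp.const_mul _).comp_ofReal
  have h4 : hankelPath ε =ᶠ[𝓝 u] fun u : ℝ => (ε : ℂ) * Complex.exp (Complex.I * u) := by
    filter_upwards [Ioo_mem_nhds h0 h1] with v hv using hankelPath_of_mem hv.1.le hv.2.le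
  rw [(h2.congr_of_eventuallyEq h4).deriv]; ring

lemma deriv_hankelPath_of_gt {ε u : ℝ} (hu : 2 * Real.pi < u) : deriv (hankelPath ε) u = 1 := by
  have h1 : HasDerivAt (fun u : ℝ => ((ε + (u - 2 * Real.pi) : ℝ) : ℂ)) ((1 : ℝ) : ℂ) u :=
    (((hasDerivAt_id u).sub_const (2 * Real.pi)).const_add ε).ofReal_comp
  have h2 : hankelPath ε =ᶠ[𝓝 u] fun u : ℝ => ((ε + (u - 2 * Real.pi) : ℝ) : ℂ) := by
    filter_upwards [Ioi_mem_nhds hu] with v hv using hankelPath_of_gt hv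
  rw [(h1.congr_of_eventuallyEq h2).deriv]; simp

lemma ae_norm_deriv_hankelPath_le {ε : ℝ} (hε : 0 < ε) :
    ∀ᵐ u : ℝ, ‖deriv (hankelPath ε) u‖ ≤ 1 + ε := by
  -- The two corners of the contour, where the derivative formulas do not apply, form a null set.
  have h : ∀ᵐ u : ℝ, u ∉ ({0, 2 * Real.pi} : Set ℝ) :=
    measure_eq_zero_iff_ae_notMem.1 ((Set.toFinite _).measure_zero _)
  filter_upwards [h] with u hu
  simp only [Set.mem_insert_iff, Set.mem_singleton_iff, not_or] at hu
  rcases lt_or_gt_of_ne hu.1 with h | h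
  · rw [deriv_hankelPath_of_neg h]; simp [hε.le]
  rcases lt_or_gt_of_ne hu.2 with h' | h'
  · rw [deriv_hankelPath_of_mem h h', norm_mul, norm_mul_exp_I hε]; simp
  · rw [deriv_hankelPath_of_gt h']; simp [hε.le]

lemma integrable_exp_neg_mul_abs {a : ℝ} (ha : 0 < a) :
    Integrable fun u : ℝ => Real.exp (-a * |u|) := by
  rw [← integrableOn_univ, ← Set.Iic_union_Ioi (a := (0 : ℝ)), integrableOn_union]
  constructor
  · refine (integrableOn_exp_mul_Iic ha 0).congr_fun (fun u hu => ?_) measurableSet_Iic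
    simp only [abs_of_nonpos (Set.mem_Iic.1 hu)]; congr 1; ring
  · refine (integrableOn_exp_mul_Ioi (neg_lt_zero.2 ha) 0).congr_fun (fun u hu => ?_)
      measurableSet_Ioi
    simp only [abs_of_pos (Set.mem_Ioi.1 hu)]

/-- From log x ≤ x - 1 at x = (a/N)m above, and m ≥ ε below: a power of the modulus costs only an
arbitrarily small share a of the exponential decay. -/
lemma mul_abs_log_le {ε a N m : ℝ} (hε : 0 < ε) (ha : 0 < a) (hN : 0 < N) (hm : ε ≤ m) :
    N * |Real.log m| ≤ a * m + N * (|Real.log (a / N)| + |Real.log ε|) := by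
  have hm0 : 0 < m := hε.trans_le hm
  have h1 : Real.log m ≤ a / N * m + |Real.log (a / N)| := by
    have h2 := Real.log_le_sub_one_of_pos (show 0 < a / N * m by positivity)
    rw [Real.log_mul (by positivity) hm0.ne'] at h2
    have := neg_abs_le (Real.log (a / N))
    linarith
  have h3 : -Real.log m ≤ |Real.log ε| := by
    have := Real.log_le_log hε hm
    have := neg_abs_le (Real.log ε)
    linarith
  have h4 : |Real.log m| ≤ a / N * m + (|Real.log (a / N)| + |Real.log ε|) := by
    have : 0 ≤ a / N * m := by positivity
    rw [abs_le']
    constructor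
    · linarith [abs_nonneg (Real.log ε)]
    · linarith [abs_nonneg (Real.log (a / N))]
  calc N * |Real.log m| ≤ N * (a / N * m + (|Real.log (a / N)| + |Real.log ε|)) := by gcongr
    _ = _ := by field_simp

/-- Exponential decay beats every power of `t` along the Hankel contour. -/
lemma integrable_hankel_majorant {ε b N : ℝ} (hε : 0 < ε) (hb : 0 < b) (hN : 0 < N) :
    Integrable fun u : ℝ => Real.exp (-b * (hankelPath ε u).re) *
      (Real.exp (N * ‖hankelLog ε u‖) * ‖deriv (hankelPath ε) u‖) := by
  have hm1 := measurable_hankelPath ε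
  have hm2 := measurable_hankelLog ε
  have hm3 := measurable_deriv_hankelPath ε
  -- Half of the rate b pays for the powers of t; the other half remains to make the majorant
  -- integrable.
  set D : ℝ := N * (|Real.log (b / 2 / N)| + |Real.log ε|) with hD
  refine ((integrable_exp_neg_mul_abs (half_pos hb)).const_mul
    (Real.exp (2 * b * ε + D + 2 * Real.pi * N + b * Real.pi) * (1 + ε))).mono' ?_ ?_
  · refine Measurable.aestronglyMeasurable ?_
    have : Measurable fun u => (hankelPath ε u).re := Complex.measurable_re.comp hm1
    fun_prop
  · filter_upwards [ae_norm_deriv_hankelPath_le hε] with u hu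
    rw [Real.norm_of_nonneg (by positivity), ← mul_assoc, ← Real.exp_add, mul_right_comm,
      ← Real.exp_add]
    refine mul_le_mul (Real.exp_le_exp.2 ?_) hu (norm_nonneg _) (Real.exp_pos _).le
    have h1 := hankelModulus_le_re hε u
    have h2 := norm_hankelLog_le ε u
    have h3 := mul_abs_log_le hε (half_pos hb) hN (le_hankelModulus (ε := ε) u)
    have h4 := abs_sub_le_hankelModulus hε u
    have h5 : b * (hankelModulus ε u - 2 * ε) ≤ b * (hankelPath ε u).re := by gcongr
    have h6 : N * ‖hankelLog ε u‖ ≤ N * (|Real.log (hankelModulus ε u)| + 2 * Real.pi) := by gcongr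
    have h7 : b / 2 * (|u| - 2 * Real.pi) ≤ b / 2 * hankelModulus ε u := by gcongr
    rw [← hD] at h3
    linarith

lemma norm_hankelPow_le (ε : ℝ) (a : ℂ) (u : ℝ) :
    ‖hankelPow ε a u‖ ≤ Real.exp (‖a‖ * ‖hankelLog ε u‖) := by
  rw [hankelPow_eq, ← norm_mul]
  exact Complex.norm_exp_le_exp_norm _

/-! ### Contour integrals in one variable -/

lemma integral_Ioi_comp_add_right {E : Type*} [NormedAddCommGroup E] [NormedSpace ℝ E]
    (q : ℝ → E) (a d : ℝ) : ∫ u in Set.Ioi a, q (u + d) = ∫ x in Set.Ioi (a + d), q x := by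
  have h := (measurePreserving_add_right (volume : Measure ℝ) d).setIntegral_preimage_emb
    (measurableEmbedding_addRight d) q (Set.Ioi (a + d))
  simpa using h

lemma integrableOn_Ioi_comp_add_right {E : Type*} [NormedAddCommGroup E]
    {q : ℝ → E} {a d : ℝ} :
    IntegrableOn (fun u => q (u + d)) (Set.Ioi a) ↔ IntegrableOn q (Set.Ioi (a + d)) := by
  have h := (measurePreserving_add_right (volume : Measure ℝ) d).integrableOn_comp_preimage
    (measurableEmbedding_addRight d) (f := q) (s := Set.Ioi (a + d))
  simpa [Function.comp_def] using h

/-- The integrand of `∫_𝒞 φ(t) t ^ (s - 1) dt` in the parameter of the contour. -/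
def hankelIntegrand (ε : ℝ) (φ : ℂ → ℂ) (s : ℂ) (u : ℝ) : ℂ :=
  φ (hankelPath ε u) * (hankelPow ε (s - 1) u * deriv (hankelPath ε) u)

/-- The integrand `φ(x) x ^ (s - 1)` on the positive real axis. -/
def rayIntegrand (φ : ℂ → ℂ) (s : ℂ) (x : ℝ) : ℂ := φ x * Complex.exp ((s - 1) * Real.log x)

/-- The integrand `φ(t) t ^ (s - 1) dt` in the coordinate `w = log t`. -/
def logIntegrand (φ : ℂ → ℂ) (s w : ℂ) : ℂ := φ (Complex.exp w) * Complex.exp (s * w)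

lemma hankelIntegrand_of_neg {ε : ℝ} {φ : ℂ → ℂ} {s : ℂ} {u : ℝ} (hu : u < 0) :
    hankelIntegrand ε φ s u = -rayIntegrand φ s (ε - u) := by
  rw [hankelIntegrand, rayIntegrand, hankelPow_eq, hankelPath_of_neg hu, hankelLog_of_neg hu,
    deriv_hankelPath_of_neg hu]
  ring

lemma exp_two_pi_mul_I_sub_one (s : ℂ) :
    Complex.exp ((s - 1) * (Complex.I * (2 * Real.pi)))
      = Complex.exp (2 * Real.pi * Complex.I * s) := by
  have : (s - 1) * (Complex.I * (2 * Real.pi))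
      = 2 * Real.pi * Complex.I * s - 2 * Real.pi * Complex.I := by ring
  rw [this, Complex.exp_sub, Complex.exp_two_pi_mul_I, div_one]

lemma hankelIntegrand_of_gt {ε : ℝ} {φ : ℂ → ℂ} {s : ℂ} {u : ℝ} (hu : 2 * Real.pi < u) :
    hankelIntegrand ε φ s u = Complex.exp (2 * Real.pi * Complex.I * s) *
      rayIntegrand φ s (u + (ε - 2 * Real.pi)) := by
  have h : ε + (u - 2 * Real.pi) = u + (ε - 2 * Real.pi) := by ring
  rw [hankelIntegrand, rayIntegrand, hankelPow_eq, hankelPath_of_gt hu, hankelLog_of_gt hu,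
    deriv_hankelPath_of_gt hu, mul_add, Complex.exp_add, exp_two_pi_mul_I_sub_one, h]
  ring

lemma exp_log_add {ε : ℝ} (hε : 0 < ε) (u : ℝ) :
    Complex.exp (Real.log ε + u * Complex.I) = ε * Complex.exp (Complex.I * u) := by
  rw [Complex.exp_add, ← Complex.ofReal_exp, Real.exp_log hε, mul_comm (u : ℂ)]

lemma hankelIntegrand_of_mem {ε : ℝ} (hε : 0 < ε) {φ : ℂ → ℂ} {s : ℂ} {u : ℝ} (h0 : 0 < u)
    (h1 : u < 2 * Real.pi) :
    hankelIntegrand ε φ s u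
      = Complex.I * logIntegrand φ s (Real.log ε + u * Complex.I) := by
  have h2 : Complex.exp (s * (Real.log ε + u * Complex.I))
      = Complex.exp ((s - 1) * (Real.log ε + u * Complex.I)) *
        Complex.exp (Real.log ε + u * Complex.I) := by
    rw [← Complex.exp_add]; congr 1; ring
  rw [hankelIntegrand, logIntegrand, h2, hankelPow_eq, hankelPath_of_mem h0.le h1.le,
    hankelLog_of_mem h0.le h1.le, deriv_hankelPath_of_mem h0 h1, exp_log_add hε,
    mul_comm (u : ℂ)]
  ring

lemma integrableOn_rayIntegrand {ε : ℝ} {φ : ℂ → ℂ} {s : ℂ}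
    (h : Integrable (hankelIntegrand ε φ s)) : IntegrableOn (rayIntegrand φ s) (Set.Ioi ε) := by
  have h1 : IntegrableOn (fun u => rayIntegrand φ s (u + (ε - 2 * Real.pi)))
      (Set.Ioi (2 * Real.pi)) := by
    refine IntegrableOn.congr_fun (h.const_mul
      (Complex.exp (2 * Real.pi * Complex.I * s))⁻¹).integrableOn (fun u hu => ?_)
      measurableSet_Ioi
    simp only [hankelIntegrand_of_gt (Set.mem_Ioi.1 hu)]
    rw [inv_mul_cancel_left₀ (Complex.exp_ne_zero _)]
  rw [integrableOn_Ioi_comp_add_right] at h1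
  simpa using h1

/-- Splitting a Hankel contour integral into the contributions of the two rays and the circle. -/
lemma integral_hankelIntegrand {ε : ℝ} (hε : 0 < ε) {φ : ℂ → ℂ} {s : ℂ}
    (h : Integrable (hankelIntegrand ε φ s)) :
    ∫ u, hankelIntegrand ε φ s u
      = (Complex.exp (2 * Real.pi * Complex.I * s) - 1) * (∫ x in Set.Ioi ε, rayIntegrand φ s x)
        + Complex.I * ∫ u in (0 : ℝ)..(2 * Real.pi),
            logIntegrand φ s (Real.log ε + u * Complex.I) := by
  have hpi : (0 : ℝ) < 2 * Real.pi := by positivity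
  have hleft : ∫ u in Set.Iic 0, hankelIntegrand ε φ s u
      = -∫ x in Set.Ioi ε, rayIntegrand φ s x := by
    have h1 : ∫ u in Set.Iic 0, hankelIntegrand ε φ s u
        = ∫ u in Set.Iic (0 : ℝ), -rayIntegrand φ s (-u + ε) := by
      -- The corner is dropped, since the ray formula holds only for u < 0.
      rw [integral_Iic_eq_integral_Iio, integral_Iic_eq_integral_Iio]
      refine setIntegral_congr_fun measurableSet_Iio fun u hu => ?_
      simp only [hankelIntegrand_of_neg (Set.mem_Iio.1 hu)]
      rw [neg_add_eq_sub]
    rw [h1, integral_neg, integral_comp_neg_Iic 0 (fun x => rayIntegrand φ s (x + ε)),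
      integral_Ioi_comp_add_right]
    simp
  have hright : ∫ u in Set.Ioi (2 * Real.pi), hankelIntegrand ε φ s u
      = Complex.exp (2 * Real.pi * Complex.I * s) * ∫ x in Set.Ioi ε, rayIntegrand φ s x := by
    rw [setIntegral_congr_fun measurableSet_Ioi
      (fun u hu => hankelIntegrand_of_gt (Set.mem_Ioi.1 hu)), integral_const_mul,
      integral_Ioi_comp_add_right]
    simp
  have hmid : ∫ u in (0 : ℝ)..(2 * Real.pi), hankelIntegrand ε φ s u
      = Complex.I * ∫ u in (0 : ℝ)..(2 * Real.pi),
            logIntegrand φ s (Real.log ε + u * Complex.I) := by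
    rw [← intervalIntegral.integral_const_mul, intervalIntegral.integral_of_le hpi.le,
      intervalIntegral.integral_of_le hpi.le, integral_Ioc_eq_integral_Ioo,
      integral_Ioc_eq_integral_Ioo]
    exact setIntegral_congr_fun measurableSet_Ioo
      fun u hu => hankelIntegrand_of_mem hε hu.1 hu.2
  rw [← intervalIntegral.integral_Iic_add_Ioi (b := (0 : ℝ)) h.integrableOn h.integrableOn,
    ← intervalIntegral.integral_interval_add_Ioi (a := (0 : ℝ)) (b := 2 * Real.pi)
      h.integrableOn h.integrableOn, hleft, hright, hmid]
  ring

/-- At a positive integer the integrand is single-valued and the integral vanishes. -/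
lemma integral_hankelIntegrand_natCast {ε : ℝ} (hε : 0 < ε) {φ : ℂ → ℂ}
    (hφ : DifferentiableOn ℂ φ (Metric.closedBall 0 ε)) (n : ℕ) :
    ∫ u, hankelIntegrand ε φ (n + 1) u = 0 := by
  by_cases h : Integrable (hankelIntegrand ε φ (n + 1))
  swap
  · exact integral_undef h
  have h1 : Complex.exp (2 * Real.pi * Complex.I * (n + 1)) = 1 := by
    rw [Complex.exp_eq_one_iff]
    exact ⟨n + 1, by push_cast; ring⟩
  rw [integral_hankelIntegrand hε h, h1, sub_self, zero_mul, zero_add]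
  have hd : DifferentiableOn ℂ (fun z => φ z * z ^ n) (Metric.closedBall 0 ε) :=
    hφ.mul (differentiable_pow n).differentiableOn
  have h2 := (hd.diffContOnCl_ball subset_rfl).circleIntegral_eq_zero hε.le
  rw [circleIntegral] at h2
  rw [← h2, ← intervalIntegral.integral_const_mul]
  refine intervalIntegral.integral_congr fun u _ => ?_
  have h3 : circleMap 0 ε u = Complex.exp (Real.log ε + u * Complex.I) := by
    rw [exp_log_add hε, circleMap_zero, mul_comm (u : ℂ)]
  have h4 : Complex.exp ((n + 1) * (Real.log ε + u * Complex.I))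
      = Complex.exp (Real.log ε + u * Complex.I) ^ n *
        Complex.exp (Real.log ε + u * Complex.I) := by
    rw [← Complex.exp_nat_mul, ← Complex.exp_add]; congr 1; ring
  simp only [deriv_circleMap, smul_eq_mul, h3, logIntegrand, h4]
  ring

lemma integral_rayIntegrand_eq {a b : ℝ} (ha : 0 < a) (hab : a ≤ b) {φ : ℂ → ℂ} {s : ℂ}
    (hφ : DifferentiableOn ℂ φ (Metric.closedBall 0 b)) :
    ∫ x in a..b, rayIntegrand φ s x
      = ∫ y in (Real.log a)..(Real.log b), logIntegrand φ s y := by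
  have hb : 0 < b := ha.trans_le hab
  have key := intervalIntegral.integral_deriv_smul_comp' (a := Real.log a) (b := Real.log b)
    (f := Real.exp) (f' := Real.exp) (g := rayIntegrand φ s)
    (fun x _ => Real.hasDerivAt_exp x) Real.continuous_exp.continuousOn (by
      have him : Real.exp '' Set.uIcc (Real.log a) (Real.log b) ⊆ Set.Icc a b := by
        rw [Set.uIcc_of_le (Real.log_le_log ha hab)]
        rintro _ ⟨x, hx, rfl⟩
        constructor
        · rw [← Real.log_le_iff_le_exp ha]; exact hx.1
        · rw [← Real.le_log_iff_exp_le hb]; exact hx.2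
      refine ContinuousOn.mono ?_ him
      refine ContinuousOn.mul (hφ.continuousOn.comp Complex.continuous_ofReal.continuousOn ?_) ?_
      · intro x hx
        simp only [mem_closedBall_zero_iff, Complex.norm_real, Real.norm_eq_abs]
        rw [abs_of_nonneg (ha.le.trans hx.1)]; exact hx.2
      · refine Complex.continuous_exp.comp_continuousOn (continuousOn_const.mul
          (Complex.continuous_ofReal.comp_continuousOn (Real.continuousOn_log.mono ?_)))
        intro x hx
        exact (ha.trans_le hx.1).ne')
  rw [Real.exp_log ha, Real.exp_log hb] at key
  rw [← key]
  refine intervalIntegral.integral_congr fun y _ => ?_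
  have h1 : Complex.exp (s * y) = Complex.exp ((s - 1) * y) * Complex.exp y := by
    rw [← Complex.exp_add]; congr 1; ring
  simp only [Function.comp, rayIntegrand, logIntegrand, Real.log_exp, Complex.real_smul,
    Complex.ofReal_exp, h1]
  ring

/-- Under w = log t the annulus cut along the positive axis becomes the rectangle [log ε, log ε'] ×
[0, 2π], where t^s is single-valued. Cauchy's theorem applies: the vertical sides are the two
circles, the horizontal sides are the two banks of the segment [ε, ε'], differing by the factor
e^(2πis). -/
lemma integral_hankelIntegrand_radius_of_le {ε ε' : ℝ} (hε : 0 < ε) (hle : ε ≤ ε') {φ : ℂ → ℂ}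
    (hφ : DifferentiableOn ℂ φ (Metric.closedBall 0 ε')) {s : ℂ}
    (h : Integrable (hankelIntegrand ε φ s)) (h' : Integrable (hankelIntegrand ε' φ s)) :
    ∫ u, hankelIntegrand ε φ s u = ∫ u, hankelIntegrand ε' φ s u := by
  have hε' : 0 < ε' := hε.trans_le hle
  have hpi : (0 : ℝ) < 2 * Real.pi := by positivity
  rw [integral_hankelIntegrand hε h, integral_hankelIntegrand hε' h']
  have hray := intervalIntegral.integral_Ioi_sub_Ioi (integrableOn_rayIntegrand h) hle
  rw [integral_rayIntegrand_eq hε hle hφ] at hray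
  have hdiff : DifferentiableOn ℂ (logIntegrand φ s) {w | w.re ≤ Real.log ε'} := by
    refine DifferentiableOn.mul (hφ.comp Complex.differentiable_exp.differentiableOn ?_) ?_
    · intro w hw
      rw [mem_closedBall_zero_iff, Complex.norm_exp, ← Real.le_log_iff_exp_le hε']
      exact hw
    · fun_prop
  have hrect := Complex.integral_boundary_rect_eq_zero_of_differentiableOn (logIntegrand φ s)
    (Real.log ε) ⟨Real.log ε', 2 * Real.pi⟩ (hdiff.mono (by
      intro w hw
      have := hw.1
      simp only [Set.mem_preimage, Complex.ofReal_re] at this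
      rw [Set.uIcc_of_le (Real.log_le_log hε hle)] at this
      exact this.2))
  simp only [Complex.ofReal_re, Complex.ofReal_im, smul_eq_mul] at hrect
  have htop : ∫ x in (Real.log ε)..(Real.log ε'),
        logIntegrand φ s (x + ((2 * Real.pi : ℝ) : ℂ) * Complex.I)
      = Complex.exp (2 * Real.pi * Complex.I * s) *
        ∫ y in (Real.log ε)..(Real.log ε'), logIntegrand φ s y := by
    rw [← intervalIntegral.integral_const_mul]
    refine intervalIntegral.integral_congr fun y _ => ?_
    simp only [logIntegrand, Complex.ofReal_mul, Complex.ofReal_ofNat]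
    rw [Complex.exp_add, Complex.exp_two_pi_mul_I, mul_one, mul_add, Complex.exp_add,
      mul_comm s (2 * Real.pi * Complex.I)]
    ring
  rw [htop] at hrect
  simp only [Complex.ofReal_zero, zero_mul, add_zero] at hrect
  rw [← hray] at hrect
  linear_combination (-1 : ℂ) * hrect

lemma integral_hankelIntegrand_radius {δ ε ε' : ℝ} (hε : 0 < ε) (hε' : 0 < ε') (hδ : ε < δ)
    (hδ' : ε' < δ) {φ : ℂ → ℂ} (hφ : DifferentiableOn ℂ φ (halfStrip δ)) {s : ℂ}
    (h : Integrable (hankelIntegrand ε φ s)) (h' : Integrable (hankelIntegrand ε' φ s)) :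
    ∫ u, hankelIntegrand ε φ s u = ∫ u, hankelIntegrand ε' φ s u := by
  rcases le_total ε ε' with hle | hle
  · exact integral_hankelIntegrand_radius_of_le hε hle
      (hφ.mono (closedBall_subset_halfStrip hδ')) h h'
  · exact (integral_hankelIntegrand_radius_of_le hε' hle
      (hφ.mono (closedBall_subset_halfStrip hδ)) h' h).symm

/-! ### Integrals over products of contours -/

/-- A kernel that is holomorphic and decays exponentially near the positive real axis in each
variable. -/
structure IsKernel {r : ℕ} (δ : ℝ) (b : Fin r → ℝ) (K : (Fin r → ℂ) → ℂ) : Prop where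
  measurable : Measurable K
  differentiableAt : ∀ t : Fin r → ℂ, (∀ k, t k ∈ halfStrip δ) → DifferentiableAt ℂ K t
  bound : ∃ C : ℝ, ∀ t : Fin r → ℂ, (∀ k, t k ∈ halfStrip δ) →
    ‖K t‖ ≤ C * ∏ k, Real.exp (-b k * (t k).re)

/-- A path `p` in the half strip and a weight `w` that is integrable against `e ^ (-b Re p)`. -/
structure IsWeightedPath (δ b : ℝ) (p w : ℝ → ℂ) : Prop where
  measurable_path : Measurable p
  measurable_weight : Measurable w
  mem_halfStrip : ∀ u, p u ∈ halfStrip δ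
  integrable : Integrable fun u => Real.exp (-b * (p u).re) * ‖w u‖

/-- Two weighted paths define the same functional on holomorphic functions of exponential decay. -/
def PathEquiv (δ b : ℝ) (p w p' w' : ℝ → ℂ) : Prop :=
  ∀ φ : ℂ → ℂ, Measurable φ → DifferentiableOn ℂ φ (halfStrip δ) →
    (∃ C : ℝ, ∀ t ∈ halfStrip δ, ‖φ t‖ ≤ C * Real.exp (-b * t.re)) →
    ∫ u, φ (p u) * w u = ∫ u, φ (p' u) * w' u

/-- The integrand of an integral over a product of weighted paths. -/
def prodIntegrand {r : ℕ} (K : (Fin r → ℂ) → ℂ) (p w : Fin r → ℝ → ℂ) (u : Fin r → ℝ) : ℂ :=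
  K (fun k => p k (u k)) * ∏ k, w k (u k)

lemma measurable_prodIntegrand {r : ℕ} {δ : ℝ} {b : Fin r → ℝ} {K : (Fin r → ℂ) → ℂ}
    (hK : Measurable K) {p w : Fin r → ℝ → ℂ}
    (h : ∀ k, IsWeightedPath δ (b k) (p k) (w k)) : Measurable (prodIntegrand K p w) := by
  refine Measurable.mul (hK.comp (measurable_pi_lambda _ fun k =>
    (h k).measurable_path.comp (measurable_pi_apply k))) ?_
  exact Finset.measurable_fun_prod _ fun k _ =>
    (h k).measurable_weight.comp (measurable_pi_apply k)

lemma norm_prodIntegrand_le {r : ℕ} {δ : ℝ} {b : Fin r → ℝ} {K : (Fin r → ℂ) → ℂ} {C : ℝ}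
    (hC : ∀ t : Fin r → ℂ, (∀ k, t k ∈ halfStrip δ) →
      ‖K t‖ ≤ C * ∏ k, Real.exp (-b k * (t k).re)) {p w : Fin r → ℝ → ℂ}
    (h : ∀ k u, p k u ∈ halfStrip δ) (u : Fin r → ℝ) :
    ‖prodIntegrand K p w u‖
      ≤ C * ∏ k, (Real.exp (-b k * (p k (u k)).re) * ‖w k (u k)‖) := by
  rw [prodIntegrand, norm_mul, norm_prod, Finset.prod_mul_distrib, ← mul_assoc]
  gcongr
  exact hC _ fun k => h k (u k)

lemma integrable_prod_majorant {r : ℕ} {δ : ℝ} {b : Fin r → ℝ} {p w : Fin r → ℝ → ℂ}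
    (h : ∀ k, IsWeightedPath δ (b k) (p k) (w k)) (C : ℝ) :
    Integrable fun u : Fin r → ℝ =>
      C * ∏ k, (Real.exp (-b k * (p k (u k)).re) * ‖w k (u k)‖) :=
  (Integrable.fintype_prod (f := fun k u => Real.exp (-b k * (p k u).re) * ‖w k u‖)
    fun k => (h k).integrable).const_mul C

lemma integrable_prodIntegrand {r : ℕ} {δ : ℝ} {b : Fin r → ℝ} {K : (Fin r → ℂ) → ℂ}
    (hK : Measurable K) (hK' : ∃ C : ℝ, ∀ t : Fin r → ℂ, (∀ k, t k ∈ halfStrip δ) →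
      ‖K t‖ ≤ C * ∏ k, Real.exp (-b k * (t k).re)) {p w : Fin r → ℝ → ℂ}
    (h : ∀ k, IsWeightedPath δ (b k) (p k) (w k)) : Integrable (prodIntegrand K p w) := by
  obtain ⟨C, hC⟩ := hK'
  refine (integrable_prod_majorant h C).mono'
    (measurable_prodIntegrand hK h).aestronglyMeasurable (ae_of_all _ fun u => ?_)
  exact norm_prodIntegrand_le hC (fun k => (h k).mem_halfStrip) u

lemma integral_eq_integral_insertNth {n : ℕ} {f : (Fin (n + 1) → ℝ) → ℂ} (hf : Integrable f)
    (k : Fin (n + 1)) :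
    ∫ u, f u = ∫ y : Fin n → ℝ, ∫ x : ℝ, f (k.insertNth x y) := by
  have hem := (volume_preserving_piFinSuccAbove (fun _ : Fin (n + 1) => ℝ) k).symm
  have hemb := (MeasurableEquiv.piFinSuccAbove (fun _ : Fin (n + 1) => ℝ) k).symm.measurableEmbedding
  rw [← hem.integral_comp hemb, Measure.volume_eq_prod, integral_prod_symm]
  · rfl
  · rw [← Measure.volume_eq_prod]
    exact (hem.integrable_comp_emb hemb).2 hf

/-- The kernel as a function of its `k`-th variable. -/
lemma IsKernel.slice {n : ℕ} {δ : ℝ} {b : Fin (n + 1) → ℝ} {K : (Fin (n + 1) → ℂ) → ℂ}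
    (hK : IsKernel δ b K) (k : Fin (n + 1)) {t : Fin n → ℂ} (ht : ∀ i, t i ∈ halfStrip δ) :
    Measurable (fun z : ℂ => K (k.insertNth z t)) ∧
      DifferentiableOn ℂ (fun z : ℂ => K (k.insertNth z t)) (halfStrip δ) ∧
      ∃ C : ℝ, ∀ z ∈ halfStrip δ, ‖K (k.insertNth z t)‖ ≤ C * Real.exp (-b k * z.re) := by
  have hmem : ∀ z ∈ halfStrip δ, ∀ i, (k.insertNth z t : Fin (n + 1) → ℂ) i ∈ halfStrip δ := by
    intro z hz i
    induction i using k.succAboveCases with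
    | x => simpa using hz
    | p i => simpa using ht i
  have heq : (fun z : ℂ => (k.insertNth z t : Fin (n + 1) → ℂ))
      = fun z => Function.update (k.insertNth 0 t : Fin (n + 1) → ℂ) k z := by
    funext z; simp
  refine ⟨hK.measurable.comp ?_, fun z hz => ?_, ?_⟩
  · rw [heq]; exact measurable_update _
  · refine ((hK.differentiableAt _ (hmem z hz)).comp z ?_).differentiableWithinAt
    rw [heq]
    exact (hasFDerivAt_update (𝕜 := ℂ) (E := fun _ : Fin (n + 1) => ℂ) _ z).differentiableAt
  · obtain ⟨C, hC⟩ := hK.bound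
    refine ⟨C * ∏ i, Real.exp (-b (k.succAbove i) * (t i).re), fun z hz => ?_⟩
    refine (hC _ (hmem z hz)).trans_eq ?_
    rw [k.prod_univ_succAbove]
    simp only [Fin.insertNth_apply_same, Fin.insertNth_apply_succAbove]
    ring

lemma prodIntegrand_insertNth {n : ℕ} (K : (Fin (n + 1) → ℂ) → ℂ) (p w : Fin (n + 1) → ℝ → ℂ)
    (k : Fin (n + 1)) (x : ℝ) (y : Fin n → ℝ) :
    prodIntegrand K p w (k.insertNth x y)
      = (K (k.insertNth (p k x) fun i => p (k.succAbove i) (y i)) * w k x) *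
        ∏ i, w (k.succAbove i) (y i) := by
  rw [prodIntegrand, k.prod_univ_succAbove]
  have : (fun j => p j ((k.insertNth x y : Fin (n + 1) → ℝ) j))
      = (k.insertNth (p k x) fun i => p (k.succAbove i) (y i) : Fin (n + 1) → ℂ) := by
    funext j
    induction j using k.succAboveCases with
    | x => simp
    | p i => simp
  rw [this]
  simp only [Fin.insertNth_apply_same, Fin.insertNth_apply_succAbove]
  ring

/-- By Fubini the k-th variable is integrated innermost; with the others frozen on their paths, the
kernel is one of the test functions in `PathEquiv`. -/
lemma integral_prodIntegrand_update {r : ℕ} {δ : ℝ} {b : Fin r → ℝ} {K : (Fin r → ℂ) → ℂ}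
    (hK : IsKernel δ b K) {p w : Fin r → ℝ → ℂ}
    (h : ∀ k, IsWeightedPath δ (b k) (p k) (w k)) (k : Fin r) {p' w' : ℝ → ℂ}
    (h' : IsWeightedPath δ (b k) p' w') (he : PathEquiv δ (b k) (p k) (w k) p' w') :
    ∫ u, prodIntegrand K p w u
      = ∫ u, prodIntegrand K (Function.update p k p') (Function.update w k w') u := by
  obtain _ | n := r
  · exact k.elim0
  have h2 : ∀ i, IsWeightedPath δ (b i) (Function.update p k p' i) (Function.update w k w' i) := by
    intro i
    rcases eq_or_ne i k with rfl | hi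
    · simpa using h'
    · simpa [Function.update_of_ne hi] using h i
  rw [integral_eq_integral_insertNth (integrable_prodIntegrand hK.measurable hK.bound h) k,
    integral_eq_integral_insertNth (integrable_prodIntegrand hK.measurable hK.bound h2) k]
  congr 1
  funext y
  simp only [prodIntegrand_insertNth, Function.update_self,
    Function.update_of_ne (Fin.succAbove_ne k _)]
  rw [integral_mul_const, integral_mul_const]
  congr 1
  obtain ⟨h3, h4, h5⟩ := hK.slice k (t := fun i => p (k.succAbove i) (y i))
    (fun i => (h (k.succAbove i)).mem_halfStrip (y i))
  exact he _ h3 h4 h5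

/-- Replacing each weighted path by an equivalent one does not change the integral. -/
theorem integral_prodIntegrand_congr {r : ℕ} {δ : ℝ} {b : Fin r → ℝ} {K : (Fin r → ℂ) → ℂ}
    (hK : IsKernel δ b K) {p w p' w' : Fin r → ℝ → ℂ}
    (h : ∀ k, IsWeightedPath δ (b k) (p k) (w k))
    (h' : ∀ k, IsWeightedPath δ (b k) (p' k) (w' k))
    (he : ∀ k, PathEquiv δ (b k) (p k) (w k) (p' k) (w' k)) :
    ∫ u, prodIntegrand K p w u = ∫ u, prodIntegrand K p' w' u := by
  classical
  -- S is the set of variables already replaced.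
  have key : ∀ S : Finset (Fin r), ∫ u, prodIntegrand K p w u
      = ∫ u, prodIntegrand K (S.piecewise p' p) (S.piecewise w' w) u := by
    intro S
    induction S using Finset.induction_on with
    | empty => simp
    | insert k S hk ih =>
      rw [ih, Finset.piecewise_insert, Finset.piecewise_insert]
      refine integral_prodIntegrand_update hK (fun i => ?_) k (h' k) ?_
      · by_cases hi : i ∈ S
        · simpa [hi] using h' i
        · simpa [hi] using h i
      · simpa [hk] using he k
  simpa using key Finset.univ

/-! ### Weights on the Hankel contour -/

lemma isWeightedPath_hankel {ε δ b N A : ℝ} (hε : 0 < ε) (hδ : ε < δ) (hb : 0 < b) (hN : 0 < N)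
    {v : ℝ → ℂ} (hv : Measurable v)
    (hv' : ∀ u, ‖v u‖ ≤ A * Real.exp (N * ‖hankelLog ε u‖)) :
    IsWeightedPath δ b (hankelPath ε) (fun u => v u * deriv (hankelPath ε) u) where
  measurable_path := measurable_hankelPath ε
  measurable_weight := hv.mul (measurable_deriv_hankelPath ε)
  mem_halfStrip := hankelPath_mem_halfStrip hε hδ
  integrable := by
    have hm := measurable_hankelPath ε
    have hm3 := measurable_deriv_hankelPath ε
    refine ((integrable_hankel_majorant hε hb hN).const_mul A).mono' ?_ (ae_of_all _ fun u => ?_)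
    · refine Measurable.aestronglyMeasurable ?_
      have : Measurable fun u => (hankelPath ε u).re := Complex.measurable_re.comp hm
      fun_prop
    · rw [Real.norm_of_nonneg (by positivity), norm_mul]
      calc _ ≤ Real.exp (-b * (hankelPath ε u).re) *
            (A * Real.exp (N * ‖hankelLog ε u‖) * ‖deriv (hankelPath ε) u‖) := by
              gcongr; exact hv' u
        _ = _ := by ring

lemma isWeightedPath_hankelPow {ε δ b : ℝ} (hε : 0 < ε) (hδ : ε < δ) (hb : 0 < b) (a : ℂ) :
    IsWeightedPath δ b (hankelPath ε) (fun u => hankelPow ε a u * deriv (hankelPath ε) u) := by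
  refine isWeightedPath_hankel (N := ‖a‖ + 1) (A := 1) hε hδ hb (by positivity)
    (measurable_hankelPow ε a) fun u => (norm_hankelPow_le ε a u).trans ?_
  rw [one_mul, Real.exp_le_exp]
  gcongr; linarith

lemma IsWeightedPath.integrable_mul {δ b : ℝ} {p w : ℝ → ℂ} (h : IsWeightedPath δ b p w)
    {φ : ℂ → ℂ} (hφ : Measurable φ)
    (hφ' : ∃ C : ℝ, ∀ t ∈ halfStrip δ, ‖φ t‖ ≤ C * Real.exp (-b * t.re)) :
    Integrable fun u => φ (p u) * w u := by
  obtain ⟨C, hC⟩ := hφ'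
  refine (h.integrable.const_mul C).mono'
    ((hφ.comp h.measurable_path).mul h.measurable_weight).aestronglyMeasurable
    (ae_of_all _ fun u => ?_)
  rw [norm_mul, ← mul_assoc]
  gcongr
  exact hC _ (h.mem_halfStrip u)

lemma pathEquiv_radius {ε ε' δ b : ℝ} (hε : 0 < ε) (hδ : ε < δ) (hε' : 0 < ε') (hδ' : ε' < δ)
    (hb : 0 < b) (s : ℂ) :
    PathEquiv δ b
      (hankelPath ε) (fun u => hankelPow ε (s - 1) u * deriv (hankelPath ε) u)
      (hankelPath ε') (fun u => hankelPow ε' (s - 1) u * deriv (hankelPath ε') u) :=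
  fun _ hm hd hφ => integral_hankelIntegrand_radius hε hε' hδ hδ' hd
    ((isWeightedPath_hankelPow hε hδ hb _).integrable_mul hm hφ)
    ((isWeightedPath_hankelPow hε' hδ' hb _).integrable_mul hm hφ)

/-- The weight t^n annihilates every admissible test function, so subtracting it is free; with a = s
- 1 the new weight vanishes at s = n + 1. -/
lemma pathEquiv_sub_natPow {ε δ b : ℝ} (hε : 0 < ε) (hδ : ε < δ) (hb : 0 < b) (a : ℂ) (n : ℕ) :
    PathEquiv δ b
      (hankelPath ε) (fun u => hankelPow ε a u * deriv (hankelPath ε) u)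
      (hankelPath ε) (fun u => (hankelPow ε a u - hankelPow ε n u) * deriv (hankelPath ε) u) := by
  intro φ hm hd hφ
  have h0 := integral_hankelIntegrand_natCast hε (hd.mono (closedBall_subset_halfStrip hδ)) n
  simp only [hankelIntegrand, add_sub_cancel_right] at h0
  simp only [sub_mul, mul_sub]
  rw [integral_sub ((isWeightedPath_hankelPow hε hδ hb _).integrable_mul hm hφ)
    ((isWeightedPath_hankelPow hε hδ hb _).integrable_mul hm hφ), h0, sub_zero]

/-! ### Holomorphic dependence of integrals on several complex parameters -/

/-- Cauchy's estimate on the complex line through x in each direction v. -/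
lemma norm_fderiv_le_of_norm_le {E : Type*} [NormedAddCommGroup E] [NormedSpace ℂ E]
    {f : E → ℂ} {x : E} {ρ M : ℝ} (hρ : 0 < ρ)
    (hd : ∀ z ∈ Metric.closedBall x ρ, DifferentiableAt ℂ f z)
    (hM : ∀ z ∈ Metric.closedBall x ρ, ‖f z‖ ≤ M) : ‖fderiv ℂ f x‖ ≤ M / ρ := by
  have hM0 : 0 ≤ M := (norm_nonneg _).trans (hM x (Metric.mem_closedBall_self hρ.le))
  refine ContinuousLinearMap.opNorm_le_bound _ (by positivity) fun v => ?_
  rcases eq_or_ne v 0 with rfl | hv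
  · simp
  have hv' : 0 < ‖v‖ := norm_pos_iff.2 hv
  have hmem : ∀ t ∈ Metric.closedBall (0 : ℂ) (ρ / ‖v‖), x + t • v ∈ Metric.closedBall x ρ := by
    intro t ht
    rw [mem_closedBall_zero_iff, le_div_iff₀ hv'] at ht
    rw [mem_closedBall_iff_norm, add_sub_cancel_left, norm_smul]
    exact ht
  have hline : ∀ t : ℂ, HasDerivAt (fun t : ℂ => x + t • v) v t := fun t => by
    simpa using ((hasDerivAt_id t).smul_const v).const_add x
  have hder : HasDerivAt (fun t : ℂ => f (x + t • v)) (fderiv ℂ f x v) 0 := by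
    have h1 : HasFDerivAt f (fderiv ℂ f x) (x + (0 : ℂ) • v) := by
      simpa using (hd x (Metric.mem_closedBall_self hρ.le)).hasFDerivAt
    exact h1.comp_hasDerivAt 0 (hline 0)
  have hdiff : DifferentiableOn ℂ (fun t : ℂ => f (x + t • v)) (Metric.closedBall 0 (ρ / ‖v‖)) :=
    fun t ht => ((hd _ (hmem t ht)).comp t (hline t).differentiableAt).differentiableWithinAt
  have key := Complex.norm_deriv_le_of_forall_mem_sphere_norm_le (div_pos hρ hv')
    (hdiff.diffContOnCl_ball subset_rfl)
    (fun t ht => hM _ (hmem t (Metric.sphere_subset_closedBall ht)))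
  rw [hder.deriv] at key
  refine key.trans_eq ?_
  field_simp

/-- The derivative is a finite combination of partial derivatives, each a pointwise limit of
measurable difference quotients. -/
lemma aestronglyMeasurable_fderiv_param {α : Type*} [MeasurableSpace α] {μ : Measure α} {r : ℕ}
    {f : (Fin r → ℂ) → α → ℂ} {x : Fin r → ℂ} {ρ : ℝ} (hρ : 0 < ρ)
    (hm : ∀ z ∈ Metric.closedBall x ρ, AEStronglyMeasurable (f z) μ)
    (hd : ∀ a, DifferentiableAt ℂ (fun z => f z a) x) :
    AEStronglyMeasurable (fun a => fderiv ℂ (fun z => f z a) x) μ := by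
  have hsum : (fun a => fderiv ℂ (fun z => f z a) x) = fun a => ∑ k : Fin r,
      (fderiv ℂ (fun z => f z a) x (Pi.single k 1)) •
        (ContinuousLinearMap.proj k : (Fin r → ℂ) →L[ℂ] ℂ) := by
    funext a
    ext v
    have hv : v = ∑ k, v k • (Pi.single k 1 : Fin r → ℂ) := pi_eq_sum_univ' v
    conv_lhs => rw [hv, map_sum]
    simp [mul_comm]
  rw [hsum]
  refine Finset.aestronglyMeasurable_fun_sum _ fun k _ => AEStronglyMeasurable.smul_const ?_ _
  -- The increments 1/c n = ρ/(n + 1) keep the sample points in the ball of radius ρ, where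
  -- measurability is known.
  set c : ℕ → ℂ := fun n => ((((n : ℝ) + 1) / ρ : ℝ) : ℂ) with hc
  have hcn : ∀ n, ‖c n‖ = ((n : ℝ) + 1) / ρ := fun n => by
    rw [hc, Complex.norm_real, Real.norm_of_nonneg (by positivity)]
  have hc_top : Tendsto (fun n => ‖c n‖) atTop atTop := by
    simp_rw [hcn]
    exact (tendsto_atTop_add_const_right _ _ tendsto_natCast_atTop_atTop).atTop_div_const hρ
  refine aestronglyMeasurable_of_tendsto_ae atTop
    (f := fun n a => c n • (f (x + (c n)⁻¹ • (Pi.single k 1 : Fin r → ℂ)) a - f x a))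
    (fun n => ?_) (ae_of_all _ fun a => (hd a).hasFDerivAt.lim _ hc_top)
  refine ((hm _ ?_).sub (hm x (Metric.mem_closedBall_self hρ.le))).const_smul (c n)
  rw [mem_closedBall_iff_norm, add_sub_cancel_left, norm_smul, norm_inv, hcn, Pi.norm_single,
    norm_one, mul_one, inv_div, div_le_iff₀ (by positivity)]
  have : (0 : ℝ) ≤ n := Nat.cast_nonneg n
  nlinarith

/-- Holomorphy lets Cauchy's estimate turn a majorant of the integrand into one of its derivative,
so only the integrand itself has to be dominated. -/
theorem differentiableOn_integral_param {α : Type*} [MeasurableSpace α] {μ : Measure α} {r : ℕ}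
    {f : (Fin r → ℂ) → α → ℂ} {s₀ : Fin r → ℂ} {R : ℝ} {B : α → ℝ}
    (hm : ∀ z ∈ Metric.ball s₀ R, AEStronglyMeasurable (f z) μ)
    (hd : ∀ a, DifferentiableOn ℂ (fun z => f z a) (Metric.ball s₀ R))
    (hB : ∀ a, ∀ z ∈ Metric.ball s₀ R, ‖f z a‖ ≤ B a) (hBi : Integrable B μ) :
    DifferentiableOn ℂ (fun z => ∫ a, f z a ∂μ) (Metric.ball s₀ R) := by
  intro x hx
  obtain ⟨η, hη, hsub⟩ := Metric.isOpen_iff.1 Metric.isOpen_ball x hx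
  set ρ := η / 3 with hρd
  have hρ : 0 < ρ := by positivity
  have hball : ∀ y ∈ Metric.ball x ρ, Metric.closedBall y ρ ⊆ Metric.ball s₀ R := by
    intro y hy
    refine (Metric.closedBall_subset_ball' ?_).trans hsub
    rw [Metric.mem_ball] at hy
    linarith
  have hdat : ∀ a, ∀ z ∈ Metric.ball s₀ R, DifferentiableAt ℂ (fun z => f z a) z :=
    fun a z hz => (hd a).differentiableAt (Metric.isOpen_ball.mem_nhds hz)
  have hxx := Metric.mem_ball_self (x := x) hρ
  refine (hasFDerivAt_integral_of_dominated_of_fderiv_le (𝕜 := ℂ) (s := Metric.ball x ρ)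
    (F' := fun z a => fderiv ℂ (fun z => f z a) z) (bound := fun a => B a / ρ)
    (Metric.ball_mem_nhds x hρ) ?_ ?_ ?_ ?_ (hBi.div_const ρ)
    ?_).differentiableAt.differentiableWithinAt
  · filter_upwards [Metric.isOpen_ball.mem_nhds hx] with z hz using hm z hz
  · exact hBi.mono' (hm x hx) (ae_of_all _ fun a => hB a x hx)
  · exact aestronglyMeasurable_fderiv_param hρ (fun z hz => hm z (hball x hxx hz))
      fun a => hdat a x hx
  · exact ae_of_all _ fun a z hz => norm_fderiv_le_of_norm_le hρ
      (fun y hy => hdat a y (hball z hz hy)) fun y hy => hB a y (hball z hz hy)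
  · exact ae_of_all _ fun a z hz =>
      (hdat a z (hball z hz (Metric.mem_closedBall_self hρ.le))).hasFDerivAt

lemma differentiableWithinAt_prod {E : Type*} [NormedAddCommGroup E] [NormedSpace ℂ E] {r : ℕ}
    {f : Fin r → E → ℂ} {S : Set E} {x : E} (h : ∀ k, DifferentiableWithinAt ℂ (f k) S x) :
    DifferentiableWithinAt ℂ (fun z => ∏ k, f k z) S x :=
  (HasFDerivWithinAt.finsetProd fun k _ => (h k).hasFDerivWithinAt).differentiableWithinAt

/-! ### The prefactor -/

/-- The function `Γ(1 - s) e ^ (-πis) / (2πi)`. -/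
def gammaReg (s : ℂ) : ℂ :=
  Complex.Gamma (1 - s) * Complex.exp (-(Real.pi * Complex.I * s)) / (2 * Real.pi * Complex.I)

lemma exp_sub_one_eq_sin (z : ℂ) : Complex.exp (2 * Real.pi * Complex.I * z) - 1
    = Complex.exp (Real.pi * Complex.I * z) * (2 * Complex.I * Complex.sin (Real.pi * z)) := by
  have h1 : Complex.exp (2 * Real.pi * Complex.I * z) = Complex.exp (Real.pi * Complex.I * z) *
      Complex.exp (Real.pi * z * Complex.I) := by
    rw [← Complex.exp_add]; congr 1; ring
  have h2 : Complex.exp (Real.pi * Complex.I * z) * Complex.exp (-(Real.pi * z) * Complex.I) = 1 := by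
    rw [← Complex.exp_add, ← Complex.exp_zero]; congr 1; ring
  rw [h1, Complex.sin]
  linear_combination h2 - Complex.exp (Real.pi * Complex.I * z) *
    (Complex.exp (-(Real.pi * z) * Complex.I) - Complex.exp (Real.pi * z * Complex.I)) *
      Complex.I_sq

/-- Euler's reflection formula, after writing e^(2πiz) - 1 = 2i e^(πiz) sin(πz). The right-hand side
is regular at 0, -1, -2, …, which supplies the extension by continuity of the prefactor. -/
lemma one_div_exp_sub_one_mul_Gamma {z : ℂ} (hz : Complex.sin (Real.pi * z) ≠ 0) :
    1 / ((Complex.exp (2 * Real.pi * Complex.I * z) - 1) * Complex.Gamma z) = gammaReg z := by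
  have hpi : (Real.pi : ℂ) ≠ 0 := by exact_mod_cast Real.pi_ne_zero
  have h1 := Complex.Gamma_mul_Gamma_one_sub z
  have h3 : Complex.Gamma z ≠ 0 := by
    intro h
    rw [h, zero_mul] at h1
    exact div_ne_zero hpi hz h1.symm
  rw [eq_div_iff hz] at h1
  rw [exp_sub_one_eq_sin, gammaReg, Complex.exp_neg]
  have he := Complex.exp_ne_zero (Real.pi * Complex.I * z)
  have hI := Complex.I_ne_zero
  field_simp
  linear_combination -h1

lemma eventually_sin_ne_zero (s : ℂ) : ∀ᶠ z in 𝓝[≠] s, Complex.sin (Real.pi * z) ≠ 0 := by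
  have hd : Differentiable ℂ fun z : ℂ => Complex.sin (Real.pi * z) := by fun_prop
  have han : AnalyticOnNhd ℂ (fun z : ℂ => Complex.sin (Real.pi * z)) Set.univ :=
    fun z _ => hd.analyticAt z
  rcases (hd.analyticAt s).eventually_eq_zero_or_eventually_ne_zero with h | h
  · exfalso
    have h1 := han.eqOn_zero_of_preconnected_of_eventuallyEq_zero isPreconnected_univ
      (Set.mem_univ s) h (Set.mem_univ (1 / 2))
    have h2 : (Real.pi : ℂ) * (1 / 2) = ((Real.pi / 2 : ℝ) : ℂ) := by push_cast; ring
    simp only [h2, ← Complex.ofReal_sin, Real.sin_pi_div_two] at h1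
    simp at h1
  · exact h

lemma ne_natCast_add_one_of_sin_ne_zero {z : ℂ} (hz : Complex.sin (Real.pi * z) ≠ 0) (n : ℕ) :
    z ≠ (n : ℂ) + 1 := by
  rintro rfl
  refine hz (Complex.sin_eq_zero_iff.2 ⟨n + 1, ?_⟩)
  push_cast; ring

lemma eventually_ne_natCast_add_one {s : ℂ} (hs : ∀ n : ℕ, s ≠ (n : ℂ) + 1) :
    ∀ᶠ z in 𝓝 s, ∀ n : ℕ, z ≠ (n : ℂ) + 1 := by
  have h := eventually_sin_ne_zero s
  rw [eventually_nhdsWithin_iff] at h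
  filter_upwards [h] with z hz n
  rcases eq_or_ne z s with rfl | hzs
  · exact hs n
  · exact ne_natCast_add_one_of_sin_ne_zero (hz hzs) n

lemma differentiableAt_gammaReg {s : ℂ} (hs : ∀ n : ℕ, s ≠ (n : ℂ) + 1) :
    DifferentiableAt ℂ gammaReg s := by
  have h1 : DifferentiableAt ℂ Complex.Gamma (1 - s) := by
    refine Complex.differentiableAt_Gamma _ fun m hm => hs m ?_
    linear_combination -hm
  have h2 : DifferentiableAt ℂ (fun z => Complex.Gamma (1 - z)) s :=
    h1.comp s (by fun_prop)
  unfold gammaReg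
  fun_prop

lemma gammaFactor_eq {s : ℂ} (hs : ∀ n : ℕ, s ≠ (n : ℂ) + 1) : gammaFactor s = gammaReg s := by
  refine Tendsto.limUnder_eq ?_
  refine ((differentiableAt_gammaReg hs).continuousAt.tendsto.mono_left
    nhdsWithin_le_nhds).congr' ?_
  filter_upwards [eventually_sin_ne_zero s] with z hz using (one_div_exp_sub_one_mul_Gamma hz).symm

/-! ### The entire extension -/

/-- The difference quotient of `z ↦ t ^ (z - 1)` at `z = n + 1` along the Hankel contour. -/
def hankelPowSlope (ε : ℝ) (n : ℕ) (z : ℂ) (u : ℝ) : ℂ :=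
  dslope (fun z => hankelPow ε (z - 1) u) (n + 1) z

lemma hasDerivAt_hankelPow (ε : ℝ) (z : ℂ) (u : ℝ) :
    HasDerivAt (fun z => hankelPow ε (z - 1) u) (hankelPow ε (z - 1) u * hankelLog ε u) z := by
  have h : HasDerivAt (fun z : ℂ => (z - 1) * hankelLog ε u) (1 * hankelLog ε u) z :=
    ((hasDerivAt_id z).sub_const 1).mul_const _
  rw [one_mul] at h
  exact h.cexp

lemma differentiable_hankelPow (ε u : ℝ) : Differentiable ℂ fun z => hankelPow ε (z - 1) u :=
  fun z => (hasDerivAt_hankelPow ε z u).differentiableAt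

lemma differentiable_hankelPowSlope (ε : ℝ) (n : ℕ) (u : ℝ) :
    Differentiable ℂ fun z => hankelPowSlope ε n z u := by
  rw [← differentiableOn_univ]
  exact (Complex.differentiableOn_dslope univ_mem).2 (differentiable_hankelPow ε u).differentiableOn

lemma sub_mul_hankelPowSlope (ε : ℝ) (n : ℕ) (z : ℂ) (u : ℝ) :
    (z - (n + 1)) * hankelPowSlope ε n z u = hankelPow ε (z - 1) u - hankelPow ε n u := by
  have h := sub_smul_dslope (fun z => hankelPow ε (z - 1) u) ((n : ℂ) + 1) z
  simpa [hankelPowSlope] using h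

lemma measurable_hankelPowSlope (ε : ℝ) (n : ℕ) (z : ℂ) : Measurable (hankelPowSlope ε n z) := by
  rcases eq_or_ne z ((n : ℂ) + 1) with rfl | hz
  · have : hankelPowSlope ε n (n + 1)
        = fun u => hankelPow ε ((n : ℂ) + 1 - 1) u * hankelLog ε u := by
      funext u
      rw [hankelPowSlope, dslope_same, (hasDerivAt_hankelPow ε _ u).deriv]
    rw [this]
    exact (measurable_hankelPow ε _).mul (measurable_hankelLog ε)
  · have : hankelPowSlope ε n z
        = fun u => (z - (n + 1))⁻¹ * (hankelPow ε (z - 1) u - hankelPow ε n u) := by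
      funext u
      rw [← sub_mul_hankelPowSlope, inv_mul_cancel_left₀ (sub_ne_zero.2 hz)]
    rw [this]
    exact ((measurable_hankelPow ε _).sub (measurable_hankelPow ε _)).const_mul _

/-- The z-derivative of t^(z-1) is t^(z-1) log t. On the unit ball |z - 1| ≤ n + 1, and the
logarithm costs one more exponential, whence n + 2. -/
lemma norm_hankelPowSlope_le (ε : ℝ) (n : ℕ) {z : ℂ} (hz : z ∈ Metric.ball ((n : ℂ) + 1) 1)
    (u : ℝ) : ‖hankelPowSlope ε n z u‖ ≤ Real.exp ((n + 2) * ‖hankelLog ε u‖) := by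
  have hder : ∀ y ∈ Metric.ball ((n : ℂ) + 1) 1,
      ‖hankelPow ε (y - 1) u * hankelLog ε u‖ ≤ Real.exp ((n + 2) * ‖hankelLog ε u‖) := by
    intro y hy
    have h1 : ‖y - 1‖ ≤ n + 1 := by
      rw [mem_ball_iff_norm] at hy
      calc ‖y - 1‖ = ‖(y - (n + 1)) + n‖ := by congr 1; ring
        _ ≤ ‖y - (n + 1)‖ + ‖(n : ℂ)‖ := norm_add_le _ _
        _ ≤ 1 + n := by rw [Complex.norm_natCast]; gcongr
        _ = _ := add_comm _ _
    have h2 : ‖hankelLog ε u‖ ≤ Real.exp ‖hankelLog ε u‖ := by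
      linarith [Real.add_one_le_exp ‖hankelLog ε u‖]
    have h3 : ‖hankelPow ε (y - 1) u‖ ≤ Real.exp ((n + 1) * ‖hankelLog ε u‖) := by
      refine (norm_hankelPow_le _ _ _).trans ?_
      rw [Real.exp_le_exp]; gcongr
    rw [norm_mul]
    refine (mul_le_mul h3 h2 (norm_nonneg _) (Real.exp_pos _).le).trans_eq ?_
    rw [← Real.exp_add]; congr 1; ring
  have hc : (n : ℂ) + 1 ∈ Metric.ball ((n : ℂ) + 1) 1 := Metric.mem_ball_self one_pos
  rcases eq_or_ne z ((n : ℂ) + 1) with rfl | hne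
  · rw [hankelPowSlope, dslope_same, (hasDerivAt_hankelPow ε _ u).deriv]
    exact hder _ hc
  · have key := (convex_ball ((n : ℂ) + 1) 1).norm_image_sub_le_of_norm_hasDerivWithin_le
      (f := fun z => hankelPow ε (z - 1) u)
      (fun y _ => (hasDerivAt_hankelPow ε y u).hasDerivWithinAt) hder hc hz
    rw [add_sub_cancel_right, ← sub_mul_hankelPowSlope, norm_mul, mul_comm] at key
    exact le_of_mul_le_mul_right key (norm_pos_iff.2 (sub_ne_zero.2 hne))

/-- Near every point the prefactor and the weight `t ^ (z - 1)` may be replaced by a regular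
prefactor `D` and a weight `v` that define the same functional on holomorphic functions. -/
lemma exists_local_weight {ε δ b : ℝ} (hε : 0 < ε) (hδ : ε < δ) (hb : 0 < b) (z₀ : ℂ) :
    ∃ (R : ℝ) (D : ℂ → ℂ) (v : ℂ → ℝ → ℂ) (N : ℝ), 0 < R ∧ 0 < N ∧
      DifferentiableOn ℂ D (Metric.ball z₀ R) ∧
      (∀ u, Differentiable ℂ fun z => v z u) ∧
      (∀ z, Measurable (v z)) ∧
      (∀ z ∈ Metric.ball z₀ R, ∀ u, ‖v z u‖ ≤ Real.exp (N * ‖hankelLog ε u‖)) ∧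
      ∀ z ∈ Metric.ball z₀ R, (∀ n : ℕ, z ≠ (n : ℂ) + 1) → ∃ c : ℂ, gammaFactor z * c = D z ∧
        PathEquiv δ b
          (hankelPath ε) (fun u => hankelPow ε (z - 1) u * deriv (hankelPath ε) u)
          (hankelPath ε) (fun u => c * (v z u * deriv (hankelPath ε) u)) := by
  by_cases h : ∃ n : ℕ, z₀ = (n : ℂ) + 1
  · obtain ⟨n, rfl⟩ := h
    obtain ⟨R, hR, hRsin⟩ := Metric.mem_nhdsWithin_iff.1 (eventually_sin_ne_zero ((n : ℂ) + 1))
    -- E(z) = (e^(2πiz) - 1)/(z - n - 1), which has no zero near n + 1 because the zero of the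
    -- numerator there is simple. The regular prefactor is then 1/(E Γ).
    set E : ℂ → ℂ := dslope (fun z : ℂ => Complex.exp (2 * Real.pi * Complex.I * z)) (n + 1) with hE
    have hexp : Differentiable ℂ fun z : ℂ => Complex.exp (2 * Real.pi * Complex.I * z) := by
      fun_prop
    have hEd : Differentiable ℂ E := by
      rw [← differentiableOn_univ]
      exact (Complex.differentiableOn_dslope univ_mem).2 hexp.differentiableOn
    have hone : Complex.exp (2 * Real.pi * Complex.I * (n + 1)) = 1 := by
      rw [Complex.exp_eq_one_iff]
      exact ⟨n + 1, by push_cast; ring⟩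
    have hEmul : ∀ z, (z - (n + 1)) * E z = Complex.exp (2 * Real.pi * Complex.I * z) - 1 := by
      intro z
      have := sub_smul_dslope (fun z : ℂ => Complex.exp (2 * Real.pi * Complex.I * z))
        ((n : ℂ) + 1) z
      rwa [hone, smul_eq_mul] at this
    have hE0 : ∀ z ∈ Metric.ball ((n : ℂ) + 1) R, E z ≠ 0 := by
      intro z hz
      rcases eq_or_ne z ((n : ℂ) + 1) with rfl | hne
      · have hd : HasDerivAt (fun z : ℂ => Complex.exp (2 * Real.pi * Complex.I * z))
            (Complex.exp (2 * Real.pi * Complex.I * (n + 1)) * (2 * Real.pi * Complex.I * 1))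
            ((n : ℂ) + 1) :=
          ((hasDerivAt_id ((n : ℂ) + 1)).const_mul (2 * Real.pi * Complex.I)).cexp
        rw [hE, dslope_same, hd.deriv, hone]
        simp [Real.pi_ne_zero]
      · intro h0
        have h1 := hEmul z
        rw [h0, mul_zero, exp_sub_one_eq_sin, eq_comm] at h1
        have h2 : Complex.sin (Real.pi * z) ≠ 0 := hRsin ⟨hz, hne⟩
        simp [h2, Complex.exp_ne_zero] at h1
    refine ⟨min R 1, fun z => (E z)⁻¹ * (Complex.Gamma z)⁻¹, hankelPowSlope ε n, n + 2,
      lt_min hR one_pos, by positivity, ?_, differentiable_hankelPowSlope ε n,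
      measurable_hankelPowSlope ε n, ?_, ?_⟩
    · refine DifferentiableOn.mul (fun z hz => ?_)
        Complex.differentiable_one_div_Gamma.differentiableOn
      exact ((hEd z).inv (hE0 z (Metric.ball_subset_ball (min_le_left _ _) hz))).differentiableWithinAt
    · exact fun z hz u =>
        norm_hankelPowSlope_le ε n (Metric.ball_subset_ball (min_le_right _ _) hz) u
    · intro z hz hzn
      have hzR := Metric.ball_subset_ball (min_le_left R 1) hz
      -- The scalar z - (n + 1) moves from the weight to the prefactor, where it cancels the pole.
      refine ⟨z - (n + 1), ?_, ?_⟩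
      · rw [gammaFactor_eq hzn, ← one_div_exp_sub_one_mul_Gamma (hRsin ⟨hzR, hzn n⟩), ← hEmul z,
          one_div, mul_inv, mul_inv]
        have := sub_ne_zero.2 (hzn n)
        field_simp
      · have := pathEquiv_sub_natPow hε hδ hb (z - 1) n
        simp_rw [← sub_mul_hankelPowSlope, mul_assoc] at this
        exact this
  · push Not at h
    obtain ⟨R, hR, hR'⟩ := Metric.eventually_nhds_iff_ball.1 (eventually_ne_natCast_add_one h)
    refine ⟨R, gammaReg, fun z => hankelPow ε (z - 1), ‖z₀‖ + R + 1, hR, by positivity, ?_,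
      differentiable_hankelPow ε, fun z => measurable_hankelPow ε _, ?_, ?_⟩
    · exact fun z hz => (differentiableAt_gammaReg (hR' z hz)).differentiableWithinAt
    · intro z hz u
      refine (norm_hankelPow_le _ _ _).trans ?_
      rw [Real.exp_le_exp]
      gcongr
      rw [mem_ball_iff_norm] at hz
      calc ‖z - 1‖ = ‖z₀ + (z - z₀) - 1‖ := by congr 1; ring
        _ ≤ ‖z₀‖ + ‖z - z₀‖ + ‖(1 : ℂ)‖ := (norm_sub_le _ _).trans (by gcongr; exact norm_add_le _ _)
        _ ≤ _ := by rw [norm_one]; gcongr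
    · intro z hz hzn
      refine ⟨1, by rw [mul_one, gammaFactor_eq hzn], ?_⟩
      simp only [one_mul]
      exact fun _ _ _ _ => rfl

lemma exists_pos_le_forall {r : ℕ} {f : Fin r → ℝ} (hf : ∀ k, 0 < f k) :
    ∃ R : ℝ, 0 < R ∧ ∀ k, R ≤ f k := by
  have h : ∀ᶠ x : ℝ in 𝓝[>] 0, ∀ k, x ≤ f k := by
    rw [eventually_all]
    exact fun k => eventually_nhdsWithin_of_eventually_nhds (eventually_le_nhds (hf k))
  obtain ⟨R, h1, h2⟩ := ((eventually_mem_nhdsWithin (a := (0 : ℝ)) (s := Set.Ioi 0)).and h).exists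
  exact ⟨R, h1, h2⟩

/-- The points at which no factor of the prefactor has a pole. -/
def regularPoints (r : ℕ) : Set (Fin r → ℂ) := {s | ∀ k, ∀ n : ℕ, s k ≠ (n : ℂ) + 1}

lemma dense_regularPoints (r : ℕ) : Dense (regularPoints r) := by
  have h1 : regularPoints r
      = Set.pi Set.univ fun _ : Fin r => (Set.range fun n : ℕ => (n : ℂ) + 1)ᶜ := by
    ext s
    simp only [regularPoints, Set.mem_ofPred_eq, Set.mem_pi, Set.mem_univ, true_imp_iff,
      Set.mem_compl_iff, Set.mem_range, not_exists]
    exact forall_congr' fun k => forall_congr' fun n => ne_comm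
  rw [h1]
  exact dense_pi _ fun _ _ => (Set.countable_range _).dense_compl ℝ

/-- A function on a dense set that extends holomorphically near every point has an entire
extension. -/
lemma exists_entire_of_local {E : Type*} [NormedAddCommGroup E] [NormedSpace ℂ E] {S : Set E}
    (hS : Dense S) {Z : E → ℂ}
    (h : ∀ s₀, ∃ (f : E → ℂ) (R : ℝ), 0 < R ∧ DifferentiableOn ℂ f (Metric.ball s₀ R) ∧
      ∀ s ∈ Metric.ball s₀ R, s ∈ S → f s = Z s) :
    ∃ F : E → ℂ, Differentiable ℂ F ∧ ∀ s ∈ S, F s = Z s := by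
  -- Every local extension is recovered as the limit of Z along S, so extensions on overlapping
  -- balls agree and this limit defines the global function.
  have key : ∀ {s₀ : E} {f : E → ℂ} {R : ℝ}, DifferentiableOn ℂ f (Metric.ball s₀ R) →
      (∀ s ∈ Metric.ball s₀ R, s ∈ S → f s = Z s) →
      ∀ s ∈ Metric.ball s₀ R, limUnder (𝓝[S] s) Z = f s := by
    intro s₀ f R hf hZ s hs
    have hne : (𝓝[S] s).NeBot := mem_closure_iff_nhdsWithin_neBot.1 (hS s)
    have hnhds := Metric.isOpen_ball.mem_nhds hs
    refine Tendsto.limUnder_eq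
      (((hf.differentiableAt hnhds).continuousAt.tendsto.mono_left nhdsWithin_le_nhds).congr' ?_)
    filter_upwards [self_mem_nhdsWithin, nhdsWithin_le_nhds hnhds] with z hz1 hz2 using hZ z hz2 hz1
  refine ⟨fun s => limUnder (𝓝[S] s) Z, fun s₀ => ?_, fun s₀ hs₀ => ?_⟩
  all_goals obtain ⟨f, R, hR, hf, hZ⟩ := h s₀
  · have hnhds := Metric.ball_mem_nhds s₀ hR
    refine (hf.differentiableAt hnhds).congr_of_eventuallyEq ?_
    filter_upwards [hnhds] with s hs using key hf hZ s hs
  · have hs := Metric.mem_ball_self (x := s₀) hR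
    exact (key hf hZ s₀ hs).trans (hZ s₀ hs hs₀)

lemma prodIntegrand_const_mul {r : ℕ} (K : (Fin r → ℂ) → ℂ) (p w : Fin r → ℝ → ℂ) (c : Fin r → ℂ)
    (u : Fin r → ℝ) :
    prodIntegrand K p (fun k x => c k * w k x) u = (∏ k, c k) * prodIntegrand K p w u := by
  rw [prodIntegrand, prodIntegrand, Finset.prod_mul_distrib]; ring

/-- Near any point, all weights are exchanged at once for those of `exists_local_weight`; the
scalars c k leave the integral and combine with the prefactors into the regular D k. -/
theorem exists_entire_extension {r : ℕ} {ε δ : ℝ} {b : Fin r → ℝ} {K : (Fin r → ℂ) → ℂ}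
    (hε : 0 < ε) (hδ : ε < δ) (hb : ∀ k, 0 < b k) (hK : IsKernel δ b K) :
    ∃ F : (Fin r → ℂ) → ℂ, Differentiable ℂ F ∧ ∀ s ∈ regularPoints r,
      F s = (∏ k, gammaFactor (s k)) * contourIntegral ε K s := by
  refine exists_entire_of_local (dense_regularPoints r) fun s₀ => ?_
  choose R D v N hR hN hD hvd hvm hvb hvc using
    fun k => exists_local_weight hε hδ (hb k) (s₀ k)
  obtain ⟨ρ, hρ, hρR⟩ := exists_pos_le_forall hR
  obtain ⟨C, hC⟩ := hK.bound
  have hmem : ∀ z ∈ Metric.ball s₀ ρ, ∀ k, z k ∈ Metric.ball (s₀ k) (R k) := by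
    intro z hz k
    exact (dist_le_pi_dist z s₀ k).trans_lt (hz.trans_le (hρR k))
  have hw : ∀ z ∈ Metric.ball s₀ ρ, ∀ k, IsWeightedPath δ (b k) (hankelPath ε)
      (fun u => v k (z k) u * deriv (hankelPath ε) u) := fun z hz k =>
    isWeightedPath_hankel (A := 1) hε hδ (hb k) (hN k) (hvm k (z k)) fun u => by
      rw [one_mul]; exact hvb k _ (hmem z hz k) u
  -- A weight independent of z that dominates v k (z k) on the whole ball, as holomorphy under the
  -- integral requires.
  have hmaj : ∀ k, IsWeightedPath δ (b k) (hankelPath ε)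
      (fun u => ((Real.exp (N k * ‖hankelLog ε u‖) : ℝ) : ℂ) * deriv (hankelPath ε) u) := by
    intro k
    have := measurable_hankelLog ε
    refine isWeightedPath_hankel (A := 1) hε hδ (hb k) (hN k) (by fun_prop) fun u => ?_
    rw [one_mul, Complex.norm_real, Real.norm_of_nonneg (Real.exp_pos _).le]
  refine ⟨fun z => (∏ k, D k (z k)) * ∫ u, prodIntegrand K (fun _ => hankelPath ε)
    (fun k u => v k (z k) u * deriv (hankelPath ε) u) u, ρ, hρ, ?_, ?_⟩
  · refine DifferentiableOn.mul ?_ ?_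
    · exact fun z hz => differentiableWithinAt_prod fun k =>
        (hD k).comp (differentiable_apply k).differentiableOn (fun y hy => hmem y hy k) z hz
    · refine differentiableOn_integral_param
        (fun z hz => (measurable_prodIntegrand hK.measurable (hw z hz)).aestronglyMeasurable)
        (fun u => ?_) (fun u z hz => ?_) (integrable_prod_majorant hmaj |C|)
      · refine DifferentiableOn.mul (differentiableOn_const _)
          fun z hz => differentiableWithinAt_prod fun k => ?_
        exact (((hvd k (u k)).comp (differentiable_apply k)).mul_const _).differentiableOn z hz
      · refine (norm_prodIntegrand_le hC (fun _ => hankelPath_mem_halfStrip hε hδ) u).trans ?_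
        gcongr with k
        · exact le_abs_self C
        · rw [norm_mul, norm_mul, Complex.norm_real, Real.norm_of_nonneg (Real.exp_pos _).le]
          gcongr
          exact hvb k _ (hmem z hz k) _
  · intro s hs hreg
    choose c hc hce using fun k => hvc k (s k) (hmem s hs k) (hreg k)
    have hpow : ∀ k, IsWeightedPath δ (b k) (hankelPath ε)
        (fun u => hankelPow ε (s k - 1) u * deriv (hankelPath ε) u) :=
      fun k => isWeightedPath_hankelPow hε hδ (hb k) _
    have hcw : ∀ k, IsWeightedPath δ (b k) (hankelPath ε)
        (fun u => c k * (v k (s k) u * deriv (hankelPath ε) u)) := fun k =>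
      { measurable_path := (hw s hs k).measurable_path
        measurable_weight := (hw s hs k).measurable_weight.const_mul _
        mem_halfStrip := (hw s hs k).mem_halfStrip
        integrable := by
          refine ((hw s hs k).integrable.const_mul ‖c k‖).congr (ae_of_all _ fun u => ?_)
          simp only [norm_mul]; ring }
    have h1 : contourIntegral ε K s = ∫ u, prodIntegrand K (fun _ => hankelPath ε)
        (fun k u => hankelPow ε (s k - 1) u * deriv (hankelPath ε) u) u := rfl
    rw [h1, integral_prodIntegrand_congr hK hpow hcw hce]
    simp_rw [prodIntegrand_const_mul K (fun _ => hankelPath ε)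
      (fun k x => v k (s k) x * deriv (hankelPath ε) x) c]
    rw [integral_const_mul, ← mul_assoc, ← Finset.prod_mul_distrib]
    simp_rw [hc]

theorem contourIntegral_radius {r : ℕ} {ε ε' δ : ℝ} {b : Fin r → ℝ} {K : (Fin r → ℂ) → ℂ}
    (hε : 0 < ε) (hδ : ε < δ) (hε' : 0 < ε') (hδ' : ε' < δ) (hb : ∀ k, 0 < b k)
    (hK : IsKernel δ b K) (s : Fin r → ℂ) : contourIntegral ε K s = contourIntegral ε' K s :=
  integral_prodIntegrand_congr hK (p := fun _ => hankelPath ε) (p' := fun _ => hankelPath ε')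
    (fun k => isWeightedPath_hankelPow hε hδ (hb k) (s k - 1))
    (fun k => isWeightedPath_hankelPow hε' hδ' (hb k) (s k - 1))
    (fun k => pathEquiv_radius hε hδ hε' hδ' (hb k) (s k))

/-! ### The kernel of the desingularized multiple zeta-function -/

/-- At most r summands deviate, each by at most δ. The lower bound by the real part of t j is what
lets the j-th factor provide decay in the j-th variable. -/
lemma sum_Ici_mem_halfStrip {r : ℕ} {δ : ℝ} (hδ : 0 < δ) {t : Fin r → ℂ}
    (ht : ∀ k, t k ∈ halfStrip δ) (j : Fin r) :
    ∑ k ∈ Finset.Ici j, t k ∈ halfStrip ((r + 1) * δ) ∧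
      (t j).re - (r + 1) * δ ≤ (∑ k ∈ Finset.Ici j, t k).re := by
  have hcard : ∀ S : Finset (Fin r), (S.card : ℝ) * δ ≤ r * δ := by
    intro S
    have : (S.card : ℝ) ≤ r := by exact_mod_cast (Finset.card_le_univ S).trans_eq (by simp)
    gcongr
  have hre : (t j).re - r * δ ≤ (∑ k ∈ Finset.Ici j, t k).re := by
    rw [← Finset.Ioi_insert, Finset.sum_insert (by simp), Complex.add_re, Complex.re_sum]
    have h1 : (Finset.Ioi j).card • (-δ) ≤ ∑ k ∈ Finset.Ioi j, (t k).re :=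
      Finset.card_nsmul_le_sum _ _ _ fun k _ => (ht k).1.le
    rw [nsmul_eq_mul] at h1
    linarith [hcard (Finset.Ioi j)]
  have him : |(∑ k ∈ Finset.Ici j, t k).im| ≤ r * δ := by
    rw [Complex.im_sum]
    refine (Finset.abs_sum_le_sum_abs _ _).trans ?_
    refine (Finset.sum_le_card_nsmul _ _ δ fun k _ => (ht k).2.le).trans ?_
    rw [nsmul_eq_mul]
    exact hcard _
  have := (ht j).1
  refine ⟨⟨?_, ?_⟩, ?_⟩ <;> linarith

lemma halfStrip_mono {δ δ' : ℝ} (h : δ ≤ δ') : halfStrip δ ⊆ halfStrip δ' :=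
  fun _ hz => ⟨by linarith [hz.1], hz.2.trans_le h⟩

/-- Regularity and uniform exponential decay of all factors of the kernel, near the positive real
axis in each variable. -/
lemma exists_kernel_bounds {r : ℕ} {γ : Fin r → ℂ} (hγ : ∀ j, 0 < (γ j).re) :
    ∃ (δ : ℝ) (b C : Fin r → ℝ), 0 < δ ∧ (∀ j, 0 < b j) ∧
      ∀ t : Fin r → ℂ, (∀ k, t k ∈ halfStrip δ) → ∀ j,
        expQuot (tailArg γ t j) ≠ 0 ∧
        ‖deriv bernoulliGen (tailArg γ t j)‖ ≤ C j * Real.exp (-b j * (t j).re) ∧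
        ∀ c : ℝ, |c - 1| ≤ 1 / 2 →
          ‖kernelFactor c (tailArg γ t j)‖ ≤ |c - 1| * (C j * Real.exp (-b j * (t j).re)) := by
  choose δ' b C hδ' hb hC h using fun j => exists_factor_bounds (hγ j)
  obtain ⟨η, hη, hηδ⟩ := exists_pos_le_forall hδ'
  have hr : (0 : ℝ) < r + 1 := by positivity
  -- This width brings all tail sums into the half strip of width η; e^(b j η) compensates for real
  -- parts lost to the other variables.
  refine ⟨η / (r + 1), b, fun j => C j * Real.exp (b j * η), by positivity, hb, fun t ht j => ?_⟩
  obtain ⟨h1, h2⟩ := sum_Ici_mem_halfStrip (by positivity) ht j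
  rw [mul_div_cancel₀ _ hr.ne'] at h1 h2
  obtain ⟨h3, h4, h5⟩ := h j _ (halfStrip_mono (hηδ j) h1)
  have hexp : C j * Real.exp (-b j * (∑ k ∈ Finset.Ici j, t k).re)
      ≤ C j * Real.exp (b j * η) * Real.exp (-b j * (t j).re) := by
    rw [mul_assoc, ← Real.exp_add]
    refine mul_le_mul_of_nonneg_left (Real.exp_le_exp.2 ?_) (hC j)
    have : b j * ((t j).re - η) ≤ b j * (∑ k ∈ Finset.Ici j, t k).re :=
      mul_le_mul_of_nonneg_left h2 (hb j).le
    linarith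
  exact ⟨h3, h4.trans hexp, fun c hc =>
    (h5 c hc).trans (mul_le_mul_of_nonneg_left hexp (abs_nonneg _))⟩

/-- The limit of the normalized kernel as `c → 1`. -/
def regKernel {r : ℕ} (γ t : Fin r → ℂ) : ℂ := ∏ j, deriv bernoulliGen (tailArg γ t j)

lemma differentiable_tailArg {r : ℕ} (γ : Fin r → ℂ) (j : Fin r) :
    Differentiable ℂ fun t => tailArg γ t j := by
  unfold tailArg
  fun_prop

lemma measurable_tailArg {r : ℕ} (γ : Fin r → ℂ) (j : Fin r) : Measurable fun t => tailArg γ t j :=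
  (differentiable_tailArg γ j).continuous.measurable

lemma measurable_kernelH {r : ℕ} (γ : Fin r → ℂ) (c : ℝ) : Measurable (kernelH γ c) :=
  Finset.measurable_fun_prod _ fun j _ => (measurable_kernelFactor c).comp (measurable_tailArg γ j)

lemma normKernel_eq_prod {r : ℕ} (γ : Fin r → ℂ) (c : ℝ) (t : Fin r → ℂ) :
    normKernel γ c t = ∏ j, ((-1) / ((c : ℂ) - 1) * kernelFactor c (tailArg γ t j)) := by
  rw [Finset.prod_mul_distrib, Finset.prod_const, Finset.card_univ, Fintype.card_fin, div_pow]
  rfl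

lemma tendsto_normKernel {r : ℕ} {γ t : Fin r → ℂ} (h : ∀ j, expQuot (tailArg γ t j) ≠ 0) :
    Tendsto (fun c : ℝ => normKernel γ c t) (𝓝[≠] 1) (𝓝 (regKernel γ t)) := by
  simp_rw [normKernel_eq_prod]
  exact tendsto_finsetProd _ fun j _ => tendsto_kernelFactor (h j)

lemma limKernel_eq {r : ℕ} {γ t : Fin r → ℂ} (h : ∀ j, expQuot (tailArg γ t j) ≠ 0) :
    limKernel γ t = regKernel γ t :=
  (tendsto_normKernel h).limUnder_eq

lemma isKernel_regKernel {r : ℕ} {γ : Fin r → ℂ} {δ : ℝ} {b C : Fin r → ℝ}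
    (h : ∀ t : Fin r → ℂ, (∀ k, t k ∈ halfStrip δ) → ∀ j, expQuot (tailArg γ t j) ≠ 0 ∧
      ‖deriv bernoulliGen (tailArg γ t j)‖ ≤ C j * Real.exp (-b j * (t j).re)) :
    IsKernel δ b (regKernel γ) where
  measurable := Finset.measurable_fun_prod _ fun j _ =>
    measurable_deriv_bernoulliGen.comp (measurable_tailArg γ j)
  differentiableAt t ht := by
    refine differentiableWithinAt_univ.1 (differentiableWithinAt_prod fun j => ?_)
    have h1 := differentiableAt_deriv_bernoulliGen (h t ht j).1
    exact (h1.comp t (differentiable_tailArg γ j t)).differentiableWithinAt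
  bound := ⟨∏ j, C j, fun t ht => by
    rw [regKernel, norm_prod, ← Finset.prod_mul_distrib]
    exact Finset.prod_le_prod (fun _ _ => norm_nonneg _) fun j _ => (h t ht j).2⟩

lemma contourIntegrand_eq_prodIntegrand {r : ℕ} (ε : ℝ) (f : (Fin r → ℂ) → ℂ) (s : Fin r → ℂ) :
    contourIntegrand ε f s = prodIntegrand f (fun _ => hankelPath ε)
      (fun k u => hankelPow ε (s k - 1) u * deriv (hankelPath ε) u) := rfl

lemma contourIntegrand_congr {r : ℕ} {ε : ℝ} {f g : (Fin r → ℂ) → ℂ}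
    (h : ∀ t : Fin r → ℂ, (∀ k, t k ∈ Set.range (hankelPath ε)) → f t = g t) (s : Fin r → ℂ) :
    contourIntegrand ε f s = contourIntegrand ε g s := by
  funext u
  rw [contourIntegrand, contourIntegrand, h _ fun k => Set.mem_range_self _]

/-- The prefactor may be absorbed into the kernel. -/
lemma preZetaDes_eq {r : ℕ} (ε : ℝ) (γ s : Fin r → ℂ) (c : ℝ) :
    preZetaDes ε γ s c
      = (∏ k, gammaFactor (s k)) * ∫ u, contourIntegrand ε (normKernel γ c) s u := by
  have h : ∀ u, contourIntegrand ε (normKernel γ c) s u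
      = (-1) ^ r / ((c : ℂ) - 1) ^ r * contourIntegrand ε (kernelH γ c) s u := fun u => by
    rw [contourIntegrand, contourIntegrand, normKernel]; ring
  simp_rw [h]
  rw [integral_const_mul, preZetaDes, contourIntegral]
  ring

end DesingZeta

/-! ### The main theorem -/

open DesingZeta
theorem mainTheorem2 (r : ℕ) (γ : Fin r → ℂ) (hγ : ∀ j, 0 < (γ j).re) :
    ∃ F : (Fin r → ℂ) → ℂ, Differentiable ℂ F ∧
      ∃ ε₀ : ℝ, 0 < ε₀ ∧ ∀ ε : ℝ, 0 < ε → ε < ε₀ →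
        -- the limits of the kernel and of its factors exist at each point of the contour
        (∀ t : Fin r → ℂ, (∀ k, t k ∈ Set.range (DesingZeta.hankelPath ε)) →
          Tendsto (fun c : ℝ => DesingZeta.normKernel γ c t) (𝓝[≠] 1)
              (𝓝 (DesingZeta.limKernel γ t)) ∧
          ∀ j, Tendsto
            (fun c : ℝ => (-1) / ((c : ℂ) - 1) *
              DesingZeta.kernelFactor c (DesingZeta.tailArg γ t j)) (𝓝[≠] 1)
            (𝓝 (DesingZeta.limFactor (DesingZeta.tailArg γ t j)))) ∧
        -- all contour integrals converge absolutely
        (∀ᶠ c : ℝ in 𝓝[≠] 1, ∀ s : Fin r → ℂ,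
          DesingZeta.ContourIntegrable ε (DesingZeta.kernelH γ c) s) ∧
        (∀ s : Fin r → ℂ, DesingZeta.ContourIntegrable ε (DesingZeta.limKernel γ) s) ∧
        (∀ s : Fin r → ℂ, DesingZeta.ContourIntegrable ε
          (fun t => ∏ j, DesingZeta.limFactor (DesingZeta.tailArg γ t j)) s) ∧
        -- away from the poles of the prefactor, the limit defining the function exists, may be
        -- taken inside the integral, and is the value of the entire function `F`
        ∀ s : Fin r → ℂ, (∀ k, ∀ n : ℕ, s k ≠ (n : ℂ) + 1) →
          Tendsto (fun c : ℝ => DesingZeta.preZetaDes ε γ s c) (𝓝[≠] 1)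
              (𝓝 (DesingZeta.zetaDes ε γ s)) ∧
          DesingZeta.zetaDes ε γ s =
            (∏ k, DesingZeta.gammaFactor (s k)) *
              DesingZeta.contourIntegral ε (DesingZeta.limKernel γ) s ∧
          DesingZeta.zetaDes ε γ s =
            (∏ k, DesingZeta.gammaFactor (s k)) *
              DesingZeta.contourIntegral ε
                (fun t => ∏ j, DesingZeta.limFactor (DesingZeta.tailArg γ t j)) s ∧
          F s = DesingZeta.zetaDes ε γ s := by
  obtain ⟨δ, b, C, hδ, hb, hbd⟩ := exists_kernel_bounds hγ
  have hK : IsKernel δ b (regKernel γ) :=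
    isKernel_regKernel fun t ht j => ⟨(hbd t ht j).1, (hbd t ht j).2.1⟩
  have hH : ∀ c : ℝ, |c - 1| ≤ 1 / 2 → ∀ t : Fin r → ℂ, (∀ k, t k ∈ halfStrip δ) →
      ‖kernelH γ c t‖ ≤ |c - 1| ^ r * (∏ j, C j) * ∏ k, Real.exp (-b k * (t k).re) := by
    intro c hc t ht
    rw [kernelH, norm_prod]
    refine (Finset.prod_le_prod (fun _ _ => norm_nonneg _)
      fun j _ => (hbd t ht j).2.2 c hc).trans_eq ?_
    simp [Finset.prod_mul_distrib, mul_assoc]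
  have hnear : ∀ᶠ c : ℝ in 𝓝[≠] 1, |c - 1| ≤ 1 / 2 := by
    refine eventually_nhdsWithin_of_eventually_nhds ?_
    filter_upwards [Metric.closedBall_mem_nhds (1 : ℝ) one_half_pos] with c hc
    simpa [Real.dist_eq] using hc
  -- F is built once at the reference radius δ/2, so that it does not depend on ε;
  -- `contourIntegral_radius` later transfers it to every ε < δ.
  obtain ⟨F, hF, hFs⟩ := exists_entire_extension (half_pos hδ) (half_lt_self hδ) hb hK
  refine ⟨F, hF, δ, hδ, fun ε hε hεδ => ?_⟩
  have hpath := hankelPath_mem_halfStrip hε hεδ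
  have hstrip : ∀ t : Fin r → ℂ, (∀ k, t k ∈ Set.range (hankelPath ε)) →
      ∀ k, t k ∈ halfStrip δ := by
    intro t ht k
    obtain ⟨u, hu⟩ := ht k
    exact hu ▸ hpath u
  have hreg : ∀ t : Fin r → ℂ, (∀ k, t k ∈ Set.range (hankelPath ε)) →
      ∀ j, expQuot (tailArg γ t j) ≠ 0 := fun t ht j => (hbd t (hstrip t ht) j).1
  have hpow : ∀ (s : Fin r → ℂ) (k : Fin r), IsWeightedPath δ (b k) (hankelPath ε)
      (fun u => hankelPow ε (s k - 1) u * deriv (hankelPath ε) u) :=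
    fun s k => isWeightedPath_hankelPow hε hεδ (hb k) _
  have hlim : ∀ s, contourIntegrand ε (limKernel γ) s = contourIntegrand ε (regKernel γ) s :=
    contourIntegrand_congr fun t ht => limKernel_eq (hreg t ht)
  have hfac : ∀ s, contourIntegrand ε (fun t => ∏ j, limFactor (tailArg γ t j)) s
      = contourIntegrand ε (regKernel γ) s :=
    contourIntegrand_congr fun t ht => Finset.prod_congr rfl fun j _ => limFactor_eq (hreg t ht j)
  have hint : ∀ s, Integrable (contourIntegrand ε (regKernel γ) s) := fun s => by
    rw [contourIntegrand_eq_prodIntegrand]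
    exact integrable_prodIntegrand hK.measurable hK.bound (hpow s)
  refine ⟨fun t ht => ⟨?_, fun j => ?_⟩, ?_, fun s => ?_, fun s => ?_, fun s hs => ?_⟩
  · rw [limKernel_eq (hreg t ht)]
    exact tendsto_normKernel (hreg t ht)
  · rw [limFactor_eq (hreg t ht j)]
    exact tendsto_kernelFactor (hreg t ht j)
  · filter_upwards [hnear] with c hc s
    rw [ContourIntegrable, contourIntegrand_eq_prodIntegrand]
    exact integrable_prodIntegrand (measurable_kernelH γ c) ⟨_, hH c hc⟩ (hpow s)
  · rw [ContourIntegrable, hlim]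
    exact hint s
  · rw [ContourIntegrable, hfac]
    exact hint s
  have htend : Tendsto (fun c : ℝ => preZetaDes ε γ s c) (𝓝[≠] 1)
      (𝓝 ((∏ k, gammaFactor (s k)) * contourIntegral ε (regKernel γ) s)) := by
    simp_rw [preZetaDes_eq, contourIntegral, contourIntegrand_eq_prodIntegrand]
    -- The factor |c - 1|^r in `hH` cancels the normalization, so the majorant is independent of c.
    refine Tendsto.const_mul _ (tendsto_integral_filter_of_dominated_convergence _ ?_ ?_
      (integrable_prod_majorant (hpow s) (∏ j, C j)) ?_)
    · refine Eventually.of_forall fun c => Measurable.aestronglyMeasurable ?_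
      exact measurable_prodIntegrand ((measurable_kernelH γ c).const_mul _) (hpow s)
    · filter_upwards [hnear, self_mem_nhdsWithin] with c hc hc1
      refine ae_of_all _ fun u => norm_prodIntegrand_le (fun t ht => ?_) (fun _ => hpath) u
      have hc0 : 0 < |c - 1| := abs_pos.2 (sub_ne_zero.2 hc1)
      have hcn : ‖(c : ℂ) - 1‖ = |c - 1| := by
        rw [← Complex.ofReal_one, ← Complex.ofReal_sub, Complex.norm_real, Real.norm_eq_abs]
      rw [normKernel, norm_mul, norm_div, norm_pow, norm_pow, hcn, norm_neg, norm_one, one_pow,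
        one_div, inv_mul_le_iff₀ (by positivity)]
      exact (hH c hc t ht).trans_eq (by ring)
    · refine ae_of_all _ fun u => Tendsto.mul_const _ (tendsto_normKernel (hreg _ fun k => ?_))
      exact Set.mem_range_self _
  have hzeta : zetaDes ε γ s = (∏ k, gammaFactor (s k)) * contourIntegral ε (regKernel γ) s :=
    htend.limUnder_eq
  refine ⟨hzeta ▸ htend, ?_, ?_, ?_⟩
  · rw [hzeta, contourIntegral, contourIntegral, hlim]
  · rw [hzeta, contourIntegral, contourIntegral, hfac]
  · rw [hzeta, hFs s hs,
      contourIntegral_radius (half_pos hδ) (half_lt_self hδ) hε hεδ hb hK s]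

end
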